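/- **Setting.** Fix a set of datasets and two distinct datasets $D_1\neq D_2$. For probability distributions $P,Q$ on a measurable space $\Omega$, let $\frac{dP}{dQ}:=\frac{dP}{d\nu}/\frac{dQ}{d\nu}$ for a dominating measure $\nu$ (e.g. $\nu=P+Q$, with $\cdot/0:=\infty$), and let $\mathrm{PLD}(P\,\|\,Q)$ be the law on $\mathbb R\cup\{\infty\}$ of $\log\frac{dP}{dQ}(\omega)$ for $\omega\sim P$. A *privacy loss distribution* (PLD) is a law of this form. Write $\mathrm{Id}$ for the point mass at $0$ and $L\oplus L'$ for the convolution of PLDs, which is again a PLD. The Blackwell order on pairs is: $(P,Q)\preceq(P',Q')$ if there is a Markov kernel $\phi$ with $P=\phi P'$ and $Q=\phi Q'$. For PLDs, $L\preceq L'$ means that there are pairs with $L=\mathrm{PLD}(P\,\|\,Q)$, $L'=\mathrm{PLD}(P'\,\|\,Q')$ and $(P,Q)\preceq(P',Q')$. Suprema of sets of PLDs are least upper bounds with respect to $\preceq$. A *mechanism* assigns to each dataset $D$ a distribution $M(D)$, and $\mathrm{PLD}(M):=\mathrm{PLD}(M(D_1)\,\|\,M(D_2))$. An *adaptively composed mechanism*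 $M=M_1\otimes\dots\otimes M_k$ with outcome spaces $\mathcal Y_1,\dots,\mathcal Y_k$ consists of Markov kernels $M_i(D;y_1,\dots,y_{i-1})$ to $\mathcal Y_i$, one for each dataset $D$ and each $i$. Here $M(D)$ is the joint law of $(Y_1,\dots,Y_k)$ with $Y_i\sim M_i(D;Y_1,\dots,Y_{i-1})$. A *privacy rule* $\Gamma$ of length $k\ge 1$ assigns to each sequence $(L_1,\dots,L_{k'})$ of PLDs, $0\le k'<k$, a set $\Gamma(L_1,\dots,L_{k'})$ of PLDs containing $\mathrm{Id}$; $\lambda$ denotes the empty sequence. A *$\Gamma$-adversary* is an adaptively composed mechanism $M=M_1\otimes\dots\otimes M_k$ such that, for all outcomes $(y_1,\dots,y_{k-1})$ and all $1\le i\le k$, $$L_i:=\mathrm{PLD}(M_i(\cdot;y_1,\dots,y_{i-1}))\in\Gamma(L_1,\dots,L_{i-1}).$$ Let $\mathrm{PLD}(\Gamma):=\sup\{\mathrm{PLD}(M): M \text{ a }\Gamma\text{-adversary}\}$. For a rule $\Gamma$ of length $k>1$ and a PLD $L$, let $\Gamma_L$ be the rule of length $k-1$ given by $\Gamma_L(L_1,\dots,L_{k'}):=\Gamma(L,L_1,\dots,L_{k'})$.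 **Lemma.** Let $\Gamma$ be a privacy rule of length $k\ge1$. Then the supremum defining $\mathrm{PLD}(\Gamma)$ exists. Moreover: - if $k=1$, then $\mathrm{PLD}(\Gamma)=\sup\Gamma(\lambda)$; - if $k>1$, then $$\mathrm{PLD}(\Gamma)=\sup\{L\oplus\mathrm{PLD}(\Gamma_L): L\in\Gamma(\lambda)\}.$$ In both cases the supremum on the right-hand side exists. -/

import Mathlib

open MeasureTheory ProbabilityTheory
open scoped ENNReal

universe u

/-! ### Privacy loss distributions -/

/-- The likelihood ratio `dP/dQ`, computed with respect to the dominating measure `P + Q`. -/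
noncomputable def likelihoodRatio {Ω : Type*} [MeasurableSpace Ω] (P Q : Measure Ω) (ω : Ω) :
    ℝ≥0∞ :=
  P.rnDeriv (P + Q) ω / Q.rnDeriv (P + Q) ω

/-- The law of `log (dP/dQ (ω))` for `ω ∼ P`, as a measure on the extended reals. It gives no mass
to `-∞` (where `dP` vanishes), so this is a distribution on `ℝ ∪ {∞}`. -/
noncomputable def pldMeasure {Ω : Type*} [MeasurableSpace Ω] (P Q : Measure Ω) : Measure EReal :=
  P.map fun ω => ENNReal.log (likelihoodRatio P Q ω)

/-- A privacy loss distribution is the law arising from some pair of probability distributions. -/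
def IsPLD (L : Measure EReal) : Prop :=
  ∃ (Ω : Type) (_ : MeasurableSpace Ω) (P Q : Measure Ω),
    IsProbabilityMeasure P ∧ IsProbabilityMeasure Q ∧ L = pldMeasure P Q

/-- The type of privacy loss distributions. -/
def PLD : Type := {L : Measure EReal // IsPLD L}

theorem measurable_likelihoodRatio {Ω : Type*} [MeasurableSpace Ω] (P Q : Measure Ω) :
    Measurable (likelihoodRatio P Q) :=
  (Measure.measurable_rnDeriv _ _).div (Measure.measurable_rnDeriv _ _)

/-- The likelihood ratio may be computed with respect to any dominating measure. -/
theorem likelihoodRatio_eq_div {Ω : Type*} [MeasurableSpace Ω] {P Q ν : Measure Ω}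
    [IsFiniteMeasure P] [IsFiniteMeasure Q] [SigmaFinite ν] {p q : Ω → ℝ≥0∞}
    (hp : Measurable p) (hq : Measurable q)
    (hP : P = ν.withDensity p) (hQ : Q = ν.withDensity q) :
    likelihoodRatio P Q =ᵐ[P] fun ω => p ω / q ω := by
  have hsum : P + Q = ν.withDensity (p + q) := by
    rw [hP, hQ, withDensity_add_left hp]
  have key : ∀ (R : Measure Ω) [IsFiniteMeasure R] (r : Ω → ℝ≥0∞), Measurable r →
      R = ν.withDensity r → R ≪ P + Q →
      (fun ω => (p + q) ω * R.rnDeriv (P + Q) ω) =ᵐ[ν] r := by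
    intro R _ r hr hR hac
    have h1 : ν.withDensity ((p + q) * R.rnDeriv (P + Q)) = ν.withDensity r := by
      rw [withDensity_mul _ (hp.add hq) (Measure.measurable_rnDeriv _ _), ← hsum,
        Measure.withDensity_rnDeriv_eq _ _ hac, hR]
    exact (withDensity_eq_iff_of_sigmaFinite
      ((hp.add hq).mul (Measure.measurable_rnDeriv _ _)).aemeasurable hr.aemeasurable).1 h1
  have hPac : P ≪ P + Q := Measure.AbsolutelyContinuous.rfl.add_right Q
  have hQac : Q ≪ P + Q := by
    rw [add_comm]; exact Measure.AbsolutelyContinuous.rfl.add_right P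
  have hPν : P ≪ ν := hP ▸ withDensity_absolutelyContinuous _ _
  have e1 := hPν.ae_le (key P p hp hP hPac)
  have e2 := hPν.ae_le (key Q q hq hQ hQac)
  have ppos : ∀ᵐ ω ∂P, p ω ≠ 0 := by
    rw [hP, ae_withDensity_iff hp]
    exact Filter.Eventually.of_forall fun _ h => h
  have pfin : ∀ᵐ ω ∂P, p ω < ∞ := by
    refine hPν.ae_le (ae_lt_top' hp.aemeasurable ?_)
    rw [← setLIntegral_univ, ← withDensity_apply _ MeasurableSet.univ, ← hP]
    exact measure_ne_top _ _
  have qfin : ∀ᵐ ω ∂P, q ω < ∞ := by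
    refine hPν.ae_le (ae_lt_top' hq.aemeasurable ?_)
    rw [← setLIntegral_univ, ← withDensity_apply _ MeasurableSet.univ, ← hQ]
    exact measure_ne_top _ _
  filter_upwards [e1, e2, ppos, pfin, qfin] with ω h1 h2 h3 h4 h5
  have s0 : (p + q) ω ≠ 0 := by simp [h3]
  have st : (p + q) ω ≠ ∞ := by simp [h4.ne, h5.ne]
  rw [← h1, ← h2, likelihoodRatio, ENNReal.mul_div_mul_left _ _ s0 st]

theorem pldMeasure_eq_map {Ω : Type*} [MeasurableSpace Ω] {P Q ν : Measure Ω}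
    [IsFiniteMeasure P] [IsFiniteMeasure Q] [SigmaFinite ν] {p q : Ω → ℝ≥0∞}
    (hp : Measurable p) (hq : Measurable q)
    (hP : P = ν.withDensity p) (hQ : Q = ν.withDensity q) :
    pldMeasure P Q = P.map fun ω => ENNReal.log (p ω / q ω) := by
  refine Measure.map_congr ?_
  filter_upwards [likelihoodRatio_eq_div hp hq hP hQ] with ω h
  rw [h]

/-- The point mass at zero is a privacy loss distribution. -/
theorem isPLD_dirac_zero : IsPLD (Measure.dirac 0) := by
  refine ⟨Unit, inferInstance, Measure.dirac (), Measure.dirac (), inferInstance, inferInstance, ?_⟩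
  rw [pldMeasure_eq_map (ν := Measure.dirac ()) (p := 1) (q := 1) measurable_one measurable_one
    (by simp) (by simp)]
  simp

/-- The convolution of two privacy loss distributions is a privacy loss distribution. -/
theorem IsPLD.conv {L₁ L₂ : Measure EReal} (h₁ : IsPLD L₁) (h₂ : IsPLD L₂) :
    IsPLD (Measure.conv L₁ L₂) := by
  obtain ⟨Ω₁, m₁, P₁, Q₁, hP₁, hQ₁, rfl⟩ := h₁
  obtain ⟨Ω₂, m₂, P₂, Q₂, hP₂, hQ₂, rfl⟩ := h₂
  refine ⟨Ω₁ × Ω₂, inferInstance, P₁.prod P₂, Q₁.prod Q₂, inferInstance, inferInstance, ?_⟩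
  have aP : ∀ {Ω : Type} [MeasurableSpace Ω] (P Q : Measure Ω) [IsProbabilityMeasure P]
      [IsProbabilityMeasure Q], P = (P + Q).withDensity (P.rnDeriv (P + Q)) := by
    intro Ω _ P Q _ _
    exact (Measure.withDensity_rnDeriv_eq _ _ (Measure.AbsolutelyContinuous.rfl.add_right Q)).symm
  have aQ : ∀ {Ω : Type} [MeasurableSpace Ω] (P Q : Measure Ω) [IsProbabilityMeasure P]
      [IsProbabilityMeasure Q], Q = (P + Q).withDensity (Q.rnDeriv (P + Q)) := by
    intro Ω _ P Q _ _
    rw [add_comm P Q]; exact aP Q P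
  have mlog : ∀ {Ω : Type} [MeasurableSpace Ω] (P Q : Measure Ω),
      Measurable fun ω => ENNReal.log (likelihoodRatio P Q ω) := fun P Q =>
    ENNReal.measurable_log.comp (measurable_likelihoodRatio P Q)
  have mr : ∀ {Ω : Type} [MeasurableSpace Ω] (P R : Measure Ω), Measurable (P.rnDeriv R) :=
    fun P R => Measure.measurable_rnDeriv P R
  have hP : P₁.prod P₂ = ((P₁ + Q₁).prod (P₂ + Q₂)).withDensity
      (fun z => P₁.rnDeriv (P₁ + Q₁) z.1 * P₂.rnDeriv (P₂ + Q₂) z.2) := by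
    rw [← prod_withDensity (mr _ _) (mr _ _), ← aP, ← aP]
  have hQ : Q₁.prod Q₂ = ((P₁ + Q₁).prod (P₂ + Q₂)).withDensity
      (fun z => Q₁.rnDeriv (P₁ + Q₁) z.1 * Q₂.rnDeriv (P₂ + Q₂) z.2) := by
    rw [← prod_withDensity (mr _ _) (mr _ _), ← aQ, ← aQ]
  have ftop : ∀ {Ω : Type} [MeasurableSpace Ω] (P Q R : Measure Ω) [IsProbabilityMeasure P]
      [IsProbabilityMeasure Q] [IsProbabilityMeasure R], ∀ᵐ ω ∂P, R.rnDeriv (P + Q) ω ≠ ∞ := by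
    intro Ω _ P Q R _ _ _
    exact (Measure.AbsolutelyContinuous.rfl.add_right Q).ae_le (Measure.rnDeriv_ne_top R (P + Q))
  rw [pldMeasure_eq_map (((mr _ _).comp measurable_fst).mul ((mr _ _).comp measurable_snd))
    (((mr _ _).comp measurable_fst).mul ((mr _ _).comp measurable_snd)) hP hQ]
  rw [Measure.conv, pldMeasure, pldMeasure, Measure.map_prod_map _ _ (mlog _ _) (mlog _ _),
    Measure.map_map measurable_add ((mlog _ _).prodMap (mlog _ _))]
  refine Measure.map_congr ?_
  have b1 := Measure.quasiMeasurePreserving_fst (μ := P₁) (ν := P₂) |>.ae (ftop P₁ Q₁ Q₁)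
  have b2 := Measure.quasiMeasurePreserving_snd (μ := P₁) (ν := P₂) |>.ae (ftop P₂ Q₂ Q₂)
  filter_upwards [b1, b2] with z h1 h2
  simp only [Function.comp, Prod.map, likelihoodRatio]
  rw [← ENNReal.log_mul_add]
  congr 1
  simp only [div_eq_mul_inv, Pi.mul_apply, Function.comp]
  rw [ENNReal.mul_inv (Or.inr h2) (Or.inl h1)]
  ring

namespace PLD

/-- `PLD(P ‖ Q)`. -/
noncomputable def ofPair {Ω : Type} [MeasurableSpace Ω] (P Q : Measure Ω)
    [hP : IsProbabilityMeasure P] [hQ : IsProbabilityMeasure Q] : PLD :=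
  ⟨pldMeasure P Q, Ω, inferInstance, P, Q, hP, hQ, rfl⟩

/-- The identically zero privacy loss `Id`. -/
noncomputable def id : PLD := ⟨Measure.dirac 0, isPLD_dirac_zero⟩

/-- The convolution `L₁ ⊕ L₂`. -/
noncomputable def conv (L₁ L₂ : PLD) : PLD := ⟨Measure.conv L₁.1 L₂.1, L₁.2.conv L₂.2⟩

end PLD

/-! ### The Blackwell order -/

/-- `(P, Q) ⪯ (P', Q')`: some Markov kernel maps `P'` to `P` and `Q'` to `Q`. -/
def BlackwellLE {Ω Ω' : Type*} [MeasurableSpace Ω] [MeasurableSpace Ω']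
    (P Q : Measure Ω) (P' Q' : Measure Ω') : Prop :=
  ∃ φ : Kernel Ω' Ω, IsMarkovKernel φ ∧ P = P'.bind φ ∧ Q = Q'.bind φ

/-- The Blackwell order on privacy loss distributions: `L ⪯ L'` if they are represented by pairs
`(P, Q) ⪯ (P', Q')`. -/
instance PLD.instLE : LE PLD where
  le L L' := ∃ (Ω Ω' : Type) (_ : MeasurableSpace Ω) (_ : MeasurableSpace Ω')
    (P Q : Measure Ω) (P' Q' : Measure Ω')
    (_ : IsProbabilityMeasure P) (_ : IsProbabilityMeasure Q)
    (_ : IsProbabilityMeasure P') (_ : IsProbabilityMeasure Q'),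
    L = PLD.ofPair P Q ∧ L' = PLD.ofPair P' Q' ∧ BlackwellLE P Q P' Q'

open Classical in
/-- The least upper bound of a family of privacy loss distributions in the Blackwell order
(with the arbitrary value `Id` if there is none). -/
noncomputable def PLD.sup (A : Set PLD) : PLD :=
  if h : ∃ S, IsLUB A S then h.choose else PLD.id

/-! ### Adaptively composed mechanisms -/

/-- Adaptively composed mechanisms `M₁ ⊗ ⋯ ⊗ M_k` (`k ≥ 1`) on a space of datasets `𝒟`, where
every round sees the history of all earlier outcomes. The type `X` holds the history before the
first of these `k` rounds: a round with outcomes in `Y` is, for each dataset, a Markov kernel from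
`X` to `Y`, and the later rounds see the history `X × Y`. -/
inductive AdaptiveMechanism (𝒟 : Type u) :
    (X : Type) → [MeasurableSpace X] → ℕ → Type (max 1 u)
  /-- A single round. -/
  | single {X Y : Type} [MeasurableSpace X] [MeasurableSpace Y] (κ : 𝒟 → Kernel X Y)
      (hκ : ∀ D, IsMarkovKernel (κ D)) : AdaptiveMechanism 𝒟 X 1
  /-- A first round followed by `k` more rounds. -/
  | cons {X Y : Type} [MeasurableSpace X] [MeasurableSpace Y] {k : ℕ} (κ : 𝒟 → Kernel X Y)
      (hκ : ∀ D, IsMarkovKernel (κ D)) (rest : AdaptiveMechanism 𝒟 (X × Y) k) :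
      AdaptiveMechanism 𝒟 X (k + 1)

namespace AdaptiveMechanism

/-- The space `𝒴₁ × ⋯ × 𝒴_k` of joint outcomes. -/
def Output {𝒟 : Type u} : {X : Type} → [MeasurableSpace X] → {k : ℕ} →
    AdaptiveMechanism 𝒟 X k → Type
  | _, _, _, single (Y := Y) _ _ => Y
  | _, _, _, cons (Y := Y) _ _ rest => Y × rest.Output

/-- The product σ-algebra on the space of joint outcomes. -/
instance instMeasurableSpaceOutput {𝒟 : Type u} : {X : Type} → [MeasurableSpace X] → {k : ℕ} →
    (M : AdaptiveMechanism 𝒟 X k) → MeasurableSpace M.Output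
  | _, _, _, single (Y := Y) _ _ => inferInstanceAs (MeasurableSpace Y)
  | _, _, _, cons (Y := Y) _ _ rest =>
    letI := instMeasurableSpaceOutput rest
    inferInstanceAs (MeasurableSpace (Y × rest.Output))

/-- The joint law of the outcomes on dataset `D`, given the initial history. -/
noncomputable def law {𝒟 : Type u} (D : 𝒟) : {X : Type} → [MeasurableSpace X] → {k : ℕ} →
    (M : AdaptiveMechanism 𝒟 X k) → Kernel X M.Output
  | _, _, _, single κ _ => κ D
  | _, _, _, cons κ _ rest => (κ D).compProd (rest.law D)

instance isMarkovKernel_law {𝒟 : Type u} (D : 𝒟) : {X : Type} → [MeasurableSpace X] → {k : ℕ} →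
    (M : AdaptiveMechanism 𝒟 X k) → IsMarkovKernel (M.law D)
  | _, _, _, single _ hκ => hκ D
  | _, _, _, cons κ hκ rest => by
    have := hκ D
    have := isMarkovKernel_law D rest
    exact inferInstanceAs (IsMarkovKernel ((κ D).compProd (rest.law D)))

/-- `PLD(M) = PLD(M(D₁) ‖ M(D₂))` for a mechanism with empty initial history. -/
noncomputable def pld {𝒟 : Type u} (D₁ D₂ : 𝒟) {k : ℕ} (M : AdaptiveMechanism 𝒟 Unit k) : PLD :=
  PLD.ofPair (M.law D₁ ()) (M.law D₂ ())

end AdaptiveMechanism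

/-! ### Privacy rules and their adversaries -/

/-- A privacy rule of length `k` assigns to each sequence of fewer than `k` privacy loss
distributions a collection of privacy loss distributions that includes `Id`. -/
structure PrivacyRule (k : ℕ) where
  /-- The moves allowed after the sequence of moves `l`. -/
  moves : (l : List PLD) → l.length < k → Set PLD
  id_mem : ∀ l hl, PLD.id ∈ moves l hl

namespace PrivacyRule

/-- The rule `Γ_L` of length `k - 1` given by `Γ_L(L₁, …, L_k') = Γ(L, L₁, …, L_k')`. -/
def fixFirst {k : ℕ} (Γ : PrivacyRule k) (L : PLD) : PrivacyRule (k - 1) where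
  moves l hl := Γ.moves (L :: l) (by rw [List.length_cons]; omega)
  id_mem _ _ := Γ.id_mem _ _

/-- All remaining rounds of `M`, started from the history `x` after moves with privacy loss
distributions `past`, respect the rule `Γ`: whatever the outcomes are, the privacy loss
distribution `L` of each round given the history so far is a move that `Γ` allows after the moves
made so far. -/
def Respects {𝒟 : Type u} (D₁ D₂ : 𝒟) {K : ℕ} (Γ : PrivacyRule K) :
    {X : Type} → [MeasurableSpace X] → {k : ℕ} →
    AdaptiveMechanism 𝒟 X k → List PLD → X → Prop
  | _, _, _, AdaptiveMechanism.single κ hκ, past, x =>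
    haveI := hκ D₁
    haveI := hκ D₂
    ∃ h : past.length < K, PLD.ofPair (κ D₁ x) (κ D₂ x) ∈ Γ.moves past h
  | _, _, _, AdaptiveMechanism.cons (Y := Y) κ hκ rest, past, x =>
    haveI := hκ D₁
    haveI := hκ D₂
    (∃ h : past.length < K, PLD.ofPair (κ D₁ x) (κ D₂ x) ∈ Γ.moves past h) ∧
      ∀ y : Y, Respects D₁ D₂ Γ rest (past ++ [PLD.ofPair (κ D₁ x) (κ D₂ x)]) (x, y)

/-- The set `Adv(Γ)` of `Γ`-adversaries. -/
def Adv {𝒟 : Type u} (D₁ D₂ : 𝒟) {k : ℕ} (Γ : PrivacyRule k) :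
    Set (AdaptiveMechanism 𝒟 Unit k) :=
  {M | Γ.Respects D₁ D₂ M [] ()}

/-- `PLD(Γ)`, the supremum of `PLD(M)` over all `Γ`-adversaries `M`. -/
noncomputable def pld {𝒟 : Type u} (D₁ D₂ : 𝒟) {k : ℕ} (Γ : PrivacyRule k) : PLD :=
  PLD.sup {L | ∃ M ∈ Γ.Adv D₁ D₂, L = M.pld D₁ D₂}

end PrivacyRule

/-! Everything is translated into the hockey-stick divergences `H_{a,b}(P ‖ Q) = ∫ max (a dP - b dQ)
0`, equal to the supremum of `a P(A) - b Q(A)` over events `A`. They depend only on the PLD, and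
comparing two PLDs in the Blackwell order means comparing all their hockey-stick divergences
(`PLD.le_iff_hockeyStick_le`).

For this, a PLD is represented by the law `ν` on `[0,1]` of `dP/d(P+Q)` under `P + Q`. Up to
scaling, its hockey-stick divergences form the potential `s ↦ ∫ max (y - s) 0 dν`. Ordered
potentials mean convex order, because a convex function is an affine function plus a mixture of such
hinges. Strassen's theorem turns convex order into a martingale coupling, and disintegrating the
coupling gives the Markov kernel. Conversely, a convex function with the correct ends is the
potential of its second derivative. A pointwise supremum of potentials is again of this kind, so
nonempty suprema exist and `H_{a,b}` commutes with them (`PLD.exists_hockeyStick_eq_iSup`).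

For composition, let `p`, `q` be the densities of the first round. Then `H_{a,b}(L ⊕ S) = ∫ H_{a p,
b q}(S)`: an outcome merely changes the prices `a`, `b`. Define the value of a rule by the claimed
recursion. That no adversary beats it follows by integrating over the first outcome
(`PrivacyRule.mul_law_le`).

The converse is delicate. The best next move depends on the current prices, hence on the outcome,
and an arbitrary rule offers no measurable selection. However, `H_{a,b}` is Lipschitz in `a` and
`b`, so prices can be rounded to a grid. Countably many moves then suffice, and any selection among
them is measurable (`PrivacyRule.exists_respects_near_value`). Since `D₁ ≠ D₂`, a mechanism can
realize any prescribed pair of distributions. Thus the value is the least upper bound over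
adversaries, and the recursion is its definition. -/

/-! ### Second derivatives of convex functions -/

/-- A convex function on the line is a primitive of a Stieltjes function, namely of its right
derivative. -/
theorem ConvexOn.exists_stieltjesFunction {f : ℝ → ℝ} (hf : ConvexOn ℝ Set.univ f) :
    ∃ F : StieltjesFunction ℝ,
      (∀ x, F x = Function.rightLim (fun t => derivWithin f (Set.Ioi t) t) x) ∧
      ∀ c y, c ≤ y → ∫ t in c..y, F t = f y - f c := by
  have hmono : Monotone fun t => derivWithin f (Set.Ioi t) t := by
    have := hf.monotoneOn_rightDeriv
    rwa [interior_univ, monotoneOn_univ] at this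
  refine ⟨hmono.stieltjesFunction, fun x => hmono.stieltjesFunction_eq x, fun c y hcy => ?_⟩
  have hcont : Continuous f := by
    rw [← continuousOn_univ]
    exact hf.continuousOn isOpen_univ
  rw [← intervalIntegral.integral_eq_sub_of_hasDeriv_right_of_le hcy hcont.continuousOn
    (fun x _ => hf.hasDerivWithinAt_rightDeriv_of_mem_interior (by simp))
    hmono.intervalIntegrable]
  refine intervalIntegral.integral_congr_ae ?_
  -- The Stieltjes function is the right-continuous version of the right derivative, so the two
  -- differ only at the countably many discontinuities.
  have hae : ∀ᵐ t, ContinuousAt (fun t => derivWithin f (Set.Ioi t) t) t := by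
    rw [ae_iff]
    exact hmono.countable_not_continuousAt.measure_zero _
  filter_upwards [hae] with t ht _
  rw [hmono.stieltjesFunction_eq]
  exact ht.continuousWithinAt.rightLim_eq

/-- Taylor's formula with integral remainder for the primitive of a Stieltjes function. -/
theorem StieltjesFunction.lintegral_ofReal_sub (F : StieltjesFunction ℝ) {c y d : ℝ} (hcy : c ≤ y)
    (hyd : y ≤ d) :
    ∫⁻ s in Set.Ioc c d, ENNReal.ofReal (y - s) ∂F.measure =
      ENNReal.ofReal ((∫ t in c..y, F t) - F c * (y - c)) := by
  have hint : IntervalIntegrable F volume c y := F.mono.intervalIntegrable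
  have h1 : (∫ t in c..y, F t) - F c * (y - c) = ∫ t in Set.Ioc c y, (F t - F c) := by
    rw [← intervalIntegral.integral_of_le hcy,
      intervalIntegral.integral_sub hint (by simp)]
    simp [mul_comm]
  have h2 : Integrable (fun t => F t - F c) (volume.restrict (Set.Ioc c y)) := by
    refine Integrable.sub ?_ (by simp)
    exact (intervalIntegrable_iff_integrableOn_Ioc_of_le hcy).1 hint
  have h3 : ∀ᵐ t ∂volume.restrict (Set.Ioc c y), 0 ≤ F t - F c := by
    filter_upwards [ae_restrict_mem measurableSet_Ioc] with t ht
    exact sub_nonneg.2 (F.mono ht.1.le)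
  rw [h1, ofReal_integral_eq_lintegral_ofReal h2 h3]
  have hm : MeasurableSet {p : ℝ × ℝ | p.2 ≤ p.1} := measurableSet_le measurable_snd measurable_fst
  -- `F t - F c` is the `F`-mass of `(c, t]`. Writing it as an integral over `s` allows Tonelli. The
  -- range of `s` extends to `d` so that it does not depend on `y`.
  have h4 : ∫⁻ t in Set.Ioc c y, ENNReal.ofReal (F t - F c) =
      ∫⁻ t in Set.Ioc c y, ∫⁻ s in Set.Ioc c d,
        ({p : ℝ × ℝ | p.2 ≤ p.1}.indicator 1 (t, s) : ℝ≥0∞) ∂F.measure := by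
    refine setLIntegral_congr_fun measurableSet_Ioc fun t ht => ?_
    have : (fun s => ({p : ℝ × ℝ | p.2 ≤ p.1}.indicator 1 (t, s) : ℝ≥0∞)) =
        (Set.Iic t).indicator 1 := by
      ext s; simp [Set.indicator]
    simp only [this]
    rw [lintegral_indicator_one measurableSet_Iic, Measure.restrict_apply measurableSet_Iic,
      Set.inter_comm, Set.Ioc_inter_Iic, min_eq_right (ht.2.trans hyd), F.measure_Ioc]
  rw [h4, lintegral_lintegral_swap]
  · refine setLIntegral_congr_fun measurableSet_Ioc fun s hs => ?_
    have : (fun t => ({p : ℝ × ℝ | p.2 ≤ p.1}.indicator 1 (t, s) : ℝ≥0∞)) =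
        (Set.Ici s).indicator 1 := by
      ext t; simp [Set.indicator]
    simp only [this]
    rw [lintegral_indicator_one measurableSet_Ici, Measure.restrict_apply measurableSet_Ici,
      show Set.Ici s ∩ Set.Ioc c y = Set.Icc s y by
        ext t; simp only [Set.mem_inter_iff, Set.mem_Ici, Set.mem_Ioc, Set.mem_Icc]
        exact ⟨fun h => ⟨h.1, h.2.2⟩, fun h => ⟨h.1, hs.1.trans_le h.1, h.2⟩⟩, Real.volume_Icc]
  · exact (measurable_one.indicator hm).aemeasurable

/-! ### Martingale couplings on the unit interval -/

/-- The upper envelope of a continuous family of affine functions is convex. -/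
theorem convexOn_iSup_affine {X : Type*} [TopologicalSpace X] [CompactSpace X] [Nonempty X]
    (u g w : C(X, ℝ)) : ConvexOn ℝ Set.univ fun y : ℝ => ⨆ x, (u x + g x * (y - w x)) := by
  have hbdd : ∀ y : ℝ, BddAbove (Set.range fun x => u x + g x * (y - w x)) := fun y =>
    (isCompact_range (by fun_prop)).bddAbove
  refine ⟨convex_univ, fun y _ z _ a b ha hb hab => ciSup_le fun x => ?_⟩
  have h1 := le_ciSup (hbdd y) x
  have h2 := le_ciSup (hbdd z) x
  have h3 : u x + g x * ((a • y + b • z) - w x) =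
      a * (u x + g x * (y - w x)) + b * (u x + g x * (z - w x)) := by
    simp only [smul_eq_mul]
    linear_combination -(u x - g x * w x) * hab
  rw [h3]
  exact add_le_add (mul_le_mul_of_nonneg_left h1 ha) (mul_le_mul_of_nonneg_left h2 hb)

/-- A positive functional on a subspace of continuous functions, given on a parametrization of that
subspace, is integration against a measure. -/
theorem exists_measure_of_nonneg_on_range {X T : Type*} [TopologicalSpace X] [T2Space X]
    [CompactSpace X] [MeasurableSpace X] [BorelSpace X] [AddCommGroup T] [Module ℝ T]
    (A : T →ₗ[ℝ] C(X, ℝ)) (Φ : T →ₗ[ℝ] ℝ) (hpos : ∀ t, 0 ≤ A t → 0 ≤ Φ t)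
    (hone : ∃ t, A t = 1) :
    ∃ π : Measure X, IsFiniteMeasure π ∧ ∀ t, ∫ x, A t x ∂π = Φ t := by
  -- Positivity applied to `t` and `-t` makes `Φ` vanish on the kernel of `A`, so `Φ` descends to
  -- the range of `A`.
  have hker : ∀ t, A t = 0 → Φ t = 0 := fun t ht => by
    have h1 := hpos t ht.ge
    have h2 := hpos (-t) (by simp [ht])
    rw [map_neg] at h2
    linarith
  obtain ⟨Ψ, hΨ⟩ : Φ ∈ LinearMap.range A.dualMap := by
    rw [LinearMap.range_dualMap_eq_dualAnnihilator_ker, Submodule.mem_dualAnnihilator]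
    exact fun t ht => hker t ht
  have hΨ' : ∀ t, Ψ (A t) = Φ t := fun t => LinearMap.congr_fun hΨ t
  obtain ⟨e, he⟩ := hone
  obtain ⟨Λ, hΛ, hΛpos⟩ := riesz_extension (PointedCone.positive ℝ C(X, ℝ))
    ⟨LinearMap.range A, Ψ.domRestrict (LinearMap.range A)⟩
    (by
      rintro ⟨_, t, rfl⟩ ht
      exact (hpos t ht).trans_eq (hΨ' t).symm)
    -- M. Riesz extension requires every function to become nonnegative after adding an element of
    -- the subspace. The constant `‖y‖` serves, since `1` lies in the range.
    (by
      intro y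
      refine ⟨⟨‖y‖ • A e, ‖y‖ • e, by simp⟩, fun x => ?_⟩
      have h1 := neg_abs_le (y x)
      have h2 : |y x| ≤ ‖y‖ := y.norm_coe_le_norm x
      change (0 : ℝ) ≤ ‖y‖ * A e x + y x
      rw [he, ContinuousMap.one_apply]
      linarith)
  let Λ' : CompactlySupportedContinuousMap X ℝ →ₚ[ℝ] ℝ := PositiveLinearMap.mk₀
    { toFun := fun f => Λ f.toContinuousMap
      map_add' := fun f g => Λ.map_add f.toContinuousMap g.toContinuousMap
      map_smul' := fun c f => Λ.map_smul c f.toContinuousMap }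
    fun f hf => hΛpos f.toContinuousMap hf
  refine ⟨RealRMK.rieszMeasure Λ', inferInstance, fun t => ?_⟩
  have h1 := RealRMK.integral_rieszMeasure Λ' (CompactlySupportedContinuousMap.continuousMapEquiv
    (A t))
  have h2 : Λ' (CompactlySupportedContinuousMap.continuousMapEquiv (A t)) = Λ (A t) := rfl
  rw [h2, hΛ ⟨A t, t, rfl⟩] at h1
  exact h1.trans (hΨ' t)

/-- Strassen's theorem on the unit interval: measures in convex order have a martingale coupling. -/
theorem exists_martingale_coupling (ν ν' : Measure unitInterval) [IsFiniteMeasure ν]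
    [IsFiniteMeasure ν']
    (h : ∀ f : ℝ → ℝ, ConvexOn ℝ Set.univ f → ∫ x : unitInterval, f x ∂ν ≤
      ∫ x : unitInterval, f x ∂ν') :
    ∃ π : Measure (unitInterval × unitInterval), IsFiniteMeasure π ∧
      (∀ u : C(unitInterval, ℝ), ∫ z, u z.1 ∂π = ∫ x, u x ∂ν) ∧
      (∀ v : C(unitInterval, ℝ), ∫ z, v z.2 ∂π = ∫ x, v x ∂ν') ∧
      ∀ g : C(unitInterval, ℝ), ∫ z, g z.1 * ((z.2 : ℝ) - z.1) ∂π = 0 := by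
  let c : C(unitInterval, ℝ) := ⟨Subtype.val, continuous_subtype_val⟩
  have hint : ∀ (ρ : Measure unitInterval) [IsFiniteMeasure ρ] (f : C(unitInterval, ℝ)),
      Integrable f ρ := fun ρ _ f =>
    Integrable.of_bound f.continuous.aestronglyMeasurable ‖f‖
      (Filter.Eventually.of_forall f.norm_coe_le_norm)
  -- The required values of `∫ (u(x) + v(y) + g(x)(y - x)) dπ` encode both marginals and the
  -- martingale property at once. Only positivity of this functional needs proof.
  let A : (C(unitInterval, ℝ) × C(unitInterval, ℝ) × C(unitInterval, ℝ)) →ₗ[ℝ]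
      C(unitInterval × unitInterval, ℝ) :=
    { toFun := fun t => t.1.comp ContinuousMap.fst + t.2.1.comp ContinuousMap.snd +
        t.2.2.comp ContinuousMap.fst * (c.comp ContinuousMap.snd - c.comp ContinuousMap.fst)
      map_add' := fun s t => by ext z; simp; ring
      map_smul' := fun r t => by ext z; simp }
  let Φ : (C(unitInterval, ℝ) × C(unitInterval, ℝ) × C(unitInterval, ℝ)) →ₗ[ℝ] ℝ :=
    { toFun := fun t => ∫ x, t.1 x ∂ν + ∫ x, t.2.1 x ∂ν'
      map_add' := fun s t => by
        simp only [Prod.fst_add, Prod.snd_add, ContinuousMap.add_apply]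
        rw [integral_add (hint _ _) (hint _ _), integral_add (hint _ _) (hint _ _)]
        ring
      map_smul' := fun r t => by
        simp only [Prod.smul_fst, Prod.smul_snd, ContinuousMap.smul_apply, integral_smul,
          smul_add, RingHom.id_apply] }
  have hA : ∀ u v g z, A (u, v, g) z = u z.1 + v z.2 + g z.1 * ((z.2 : ℝ) - z.1) :=
    fun _ _ _ _ => rfl
  obtain ⟨π, hπ, hπA⟩ := exists_measure_of_nonneg_on_range A Φ
    (by
      rintro ⟨u, v, g⟩ ht
      -- If `u(x) + v(y) + g(x)(y - x) ≥ 0`, the envelope `f` of the lines `-u(x) - g(x)(y - x)`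
      -- satisfies `-u ≤ f ≤ v` on the interval. As `f` is convex, the hypothesis applies between
      -- the two bounds.
      let f : ℝ → ℝ := fun y => ⨆ x, ((-u) x + (-g) x * (y - c x))
      have hf : ConvexOn ℝ Set.univ f := convexOn_iSup_affine (-u) (-g) c
      have hfc : Continuous f := by
        rw [← continuousOn_univ]
        exact hf.continuousOn isOpen_univ
      let f' : C(unitInterval, ℝ) := ⟨fun x => f x, hfc.comp continuous_subtype_val⟩
      have h1 : ∫ x, (-u) x ∂ν ≤ ∫ x, f' x ∂ν := by
        refine integral_mono (hint _ _) (hint _ _) fun x => ?_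
        have := le_ciSup (f := fun x' => (-u) x' + (-g) x' * ((x : ℝ) - c x'))
          (isCompact_range (by fun_prop)).bddAbove x
        refine le_trans (le_of_eq ?_) this
        simp [c]
      have h2 : ∫ x, f' x ∂ν' ≤ ∫ x, v x ∂ν' := by
        refine integral_mono (hint _ _) (hint _ _) fun y => ciSup_le fun x => ?_
        have : 0 ≤ A (u, v, g) (x, y) := ht (x, y)
        rw [hA] at this
        simp only [ContinuousMap.neg_apply, c, ContinuousMap.coe_mk]
        linarith
      have h3 := h f hf
      have h4 : ∫ x, (-u) x ∂ν = - ∫ x, u x ∂ν := by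
        simp only [ContinuousMap.neg_apply, integral_neg]
      show 0 ≤ ∫ x, u x ∂ν + ∫ x, v x ∂ν'
      have h5 : ∫ x, f' x ∂ν ≤ ∫ x, f' x ∂ν' := h3
      linarith)
    ⟨(1, 0, 0), by ext z; simp [hA]⟩
  refine ⟨π, hπ, fun u => ?_, fun v => ?_, fun g => ?_⟩
  · simpa [hA, Φ] using hπA (u, 0, 0)
  · simpa [hA, Φ] using hπA (0, v, 0)
  · simpa [hA, Φ] using hπA (0, 0, g)

/-! ### Hockey-stick divergences -/

namespace PLD

/-- The hockey-stick divergence `∫ max (a dP - b dQ) 0` as a function of `PLD(P ‖ Q)`. -/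
noncomputable def hockeyStick (a b : ℝ≥0∞) (L : PLD) : ℝ≥0∞ :=
  ∫⁻ l, (a - b * (EReal.exp l)⁻¹) ∂L.1

/-- Under `P`, `exp l` is `p / q`, so multiplying the integrand by the density `p` gives `a p - b
q`. Where `p = 0`, both sides vanish because subtraction is truncated. -/
theorem hockeyStick_ofPair {Ω : Type} [MeasurableSpace Ω] {P Q ν : Measure Ω}
    [IsProbabilityMeasure P] [IsProbabilityMeasure Q] [SigmaFinite ν] {p q : Ω → ℝ≥0∞}
    (hp : Measurable p) (hq : Measurable q)
    (hP : P = ν.withDensity p) (hQ : Q = ν.withDensity q) (a b : ℝ≥0∞) :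
    hockeyStick a b (ofPair P Q) = ∫⁻ ω, (a * p ω - b * q ω) ∂ν := by
  have pfin : ∀ᵐ ω ∂ν, p ω < ∞ := by
    refine ae_lt_top hp ?_
    rw [← setLIntegral_univ, ← withDensity_apply _ MeasurableSet.univ, ← hP]
    exact measure_ne_top _ _
  have qfin : ∀ᵐ ω ∂ν, q ω < ∞ := by
    refine ae_lt_top hq ?_
    rw [← setLIntegral_univ, ← withDensity_apply _ MeasurableSet.univ, ← hQ]
    exact measure_ne_top _ _
  have hm : Measurable fun l : EReal => a - b * (EReal.exp l)⁻¹ := by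
    have := EReal.measurable_exp
    fun_prop
  have hlog : Measurable fun ω => ENNReal.log (p ω / q ω) :=
    ENNReal.measurable_log.comp (hp.div hq)
  have hd : (ofPair P Q).1 = P.map fun ω => ENNReal.log (p ω / q ω) :=
    pldMeasure_eq_map hp hq hP hQ
  have hm' : Measurable fun ω => a - b * (EReal.exp (ENNReal.log (p ω / q ω)))⁻¹ := hm.comp hlog
  rw [hockeyStick, hd, lintegral_map hm hlog, hP,
    lintegral_withDensity_eq_lintegral_mul _ hp hm']
  refine lintegral_congr_ae ?_
  filter_upwards [pfin, qfin] with ω h1 h2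
  simp only [Pi.mul_apply, ENNReal.exp_log]
  rcases eq_or_ne (p ω) 0 with h0 | h0
  · simp [h0]
  · rw [ENNReal.mul_sub (fun _ _ => h1.ne), ENNReal.inv_div (Or.inl h2.ne) (Or.inr h0), mul_comm a]
    congr 1
    rw [mul_left_comm, ENNReal.mul_div_cancel h0 h1.ne]

theorem hockeyStick_ofPair_rnDeriv {Ω : Type} [MeasurableSpace Ω] (P Q : Measure Ω)
    [IsProbabilityMeasure P] [IsProbabilityMeasure Q] (a b : ℝ≥0∞) :
    hockeyStick a b (ofPair P Q) =
      ∫⁻ ω, (a * P.rnDeriv (P + Q) ω - b * Q.rnDeriv (P + Q) ω) ∂(P + Q) := by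
  refine hockeyStick_ofPair (Measure.measurable_rnDeriv _ _) (Measure.measurable_rnDeriv _ _)
    ?_ ?_ a b
  · exact (Measure.withDensity_rnDeriv_eq _ _
      (Measure.AbsolutelyContinuous.rfl.add_right Q)).symm
  · refine (Measure.withDensity_rnDeriv_eq _ _ ?_).symm
    rw [add_comm]
    exact Measure.AbsolutelyContinuous.rfl.add_right P

/-- The easy half of Neyman–Pearson, for randomized tests. These are needed for data processing,
where an event `A` pulls back to the function `φ(·, A)`. -/
theorem mul_lintegral_le_add_hockeyStick {Ω : Type} [MeasurableSpace Ω] (P Q : Measure Ω)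
    [IsProbabilityMeasure P] [IsProbabilityMeasure Q] (a b : ℝ≥0∞) {f : Ω → ℝ≥0∞}
    (hf : Measurable f) (hf1 : ∀ ω, f ω ≤ 1) :
    a * ∫⁻ ω, f ω ∂P ≤ b * ∫⁻ ω, f ω ∂Q + hockeyStick a b (ofPair P Q) := by
  have mp := Measure.measurable_rnDeriv P (P + Q)
  have mq := Measure.measurable_rnDeriv Q (P + Q)
  have mpf : Measurable fun ω => P.rnDeriv (P + Q) ω * f ω := mp.mul hf
  have mqf : Measurable fun ω => Q.rnDeriv (P + Q) ω * f ω := mq.mul hf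
  have hP := Measure.withDensity_rnDeriv_eq P (P + Q)
    (Measure.AbsolutelyContinuous.rfl.add_right Q)
  have hQ := Measure.withDensity_rnDeriv_eq Q (P + Q)
    (by rw [add_comm]; exact Measure.AbsolutelyContinuous.rfl.add_right P)
  have eP : ∫⁻ ω, f ω ∂P = ∫⁻ ω, P.rnDeriv (P + Q) ω * f ω ∂(P + Q) := by
    conv_lhs => rw [← hP]
    exact lintegral_withDensity_eq_lintegral_mul _ mp hf
  have eQ : ∫⁻ ω, f ω ∂Q = ∫⁻ ω, Q.rnDeriv (P + Q) ω * f ω ∂(P + Q) := by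
    conv_lhs => rw [← hQ]
    exact lintegral_withDensity_eq_lintegral_mul _ mq hf
  rw [eP, eQ, hockeyStick_ofPair_rnDeriv, ← lintegral_const_mul _ mpf,
    ← lintegral_const_mul _ mqf, ← lintegral_add_left (mqf.const_mul b)]
  refine lintegral_mono fun ω => ?_
  calc a * (P.rnDeriv (P + Q) ω * f ω) = (a * P.rnDeriv (P + Q) ω) * f ω := by ring
    _ ≤ (b * Q.rnDeriv (P + Q) ω + (a * P.rnDeriv (P + Q) ω - b * Q.rnDeriv (P + Q) ω)) * f ω :=
        by gcongr; exact le_add_tsub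
    _ = b * (Q.rnDeriv (P + Q) ω * f ω) +
        (a * P.rnDeriv (P + Q) ω - b * Q.rnDeriv (P + Q) ω) * f ω := by ring
    _ ≤ _ := by gcongr; exact mul_le_of_le_one_right' (hf1 ω)

theorem mul_measure_le_add_hockeyStick {Ω : Type} [MeasurableSpace Ω] (P Q : Measure Ω)
    [IsProbabilityMeasure P] [IsProbabilityMeasure Q] (a b : ℝ≥0∞) {A : Set Ω}
    (hA : MeasurableSet A) :
    a * P A ≤ b * Q A + hockeyStick a b (ofPair P Q) := by
  have := mul_lintegral_le_add_hockeyStick P Q a b (measurable_one.indicator hA)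
    (Set.indicator_le_self' (fun _ _ => zero_le) : A.indicator 1 ≤ 1)
  rwa [lintegral_indicator_one hA, lintegral_indicator_one hA] at this

/-- The hockey-stick divergence is attained on the set where `b q < a p`. -/
theorem mul_measure_eq_add_hockeyStick {Ω : Type} [MeasurableSpace Ω] {P Q ν : Measure Ω}
    [IsProbabilityMeasure P] [IsProbabilityMeasure Q] [SigmaFinite ν] {p q : Ω → ℝ≥0∞}
    (hp : Measurable p) (hq : Measurable q)
    (hP : P = ν.withDensity p) (hQ : Q = ν.withDensity q) (a b : ℝ≥0∞) :
    a * P {ω | b * q ω < a * p ω} =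
      b * Q {ω | b * q ω < a * p ω} + hockeyStick a b (ofPair P Q) := by
  have hA : MeasurableSet {ω | b * q ω < a * p ω} :=
    measurableSet_lt (hq.const_mul b) (hp.const_mul a)
  rw [hockeyStick_ofPair hp hq hP hQ]
  rw [hP, hQ, withDensity_apply _ hA, withDensity_apply _ hA, ← lintegral_const_mul _ hp,
    ← lintegral_const_mul _ hq]
  have h : ∫⁻ ω, (a * p ω - b * q ω) ∂ν =
      ∫⁻ ω in {ω | b * q ω < a * p ω}, (a * p ω - b * q ω) ∂ν := by
    rw [← lintegral_indicator hA]
    refine lintegral_congr fun ω => ?_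
    by_cases hω : b * q ω < a * p ω
    · rw [Set.indicator_of_mem (show ω ∈ {ω | b * q ω < a * p ω} from hω)]
    · rw [Set.indicator_of_notMem (show ω ∉ {ω | b * q ω < a * p ω} from hω),
        tsub_eq_zero_of_le (not_lt.1 hω)]
  rw [h, ← lintegral_add_left (hq.const_mul b)]
  refine setLIntegral_congr_fun hA fun ω hω => ?_
  exact (add_tsub_cancel_of_le (le_of_lt hω)).symm

/-- Upper bounds on the hockey-stick divergence may be checked on events. -/
theorem hockeyStick_ofPair_le {Ω : Type} [MeasurableSpace Ω] (P Q : Measure Ω)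
    [IsProbabilityMeasure P] [IsProbabilityMeasure Q] {a b c : ℝ≥0∞} (hb : b ≠ ∞)
    (h : ∀ A, MeasurableSet A → a * P A ≤ b * Q A + c) :
    hockeyStick a b (ofPair P Q) ≤ c := by
  have mp := Measure.measurable_rnDeriv P (P + Q)
  have mq := Measure.measurable_rnDeriv Q (P + Q)
  have key := mul_measure_eq_add_hockeyStick mp mq (Measure.withDensity_rnDeriv_eq P (P + Q)
    (Measure.AbsolutelyContinuous.rfl.add_right Q)).symm (Measure.withDensity_rnDeriv_eq Q (P + Q)
    (by rw [add_comm]; exact Measure.AbsolutelyContinuous.rfl.add_right P)).symm a b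
  have := h _ (measurableSet_lt (mq.const_mul b) (mp.const_mul a))
  rw [key] at this
  exact (ENNReal.add_le_add_iff_left (ENNReal.mul_ne_top hb (measure_ne_top _ _))).1 this

/-- The data processing inequality. -/
theorem hockeyStick_mono {L L' : PLD} (h : L ≤ L') {a b : ℝ≥0∞} (hb : b ≠ ∞) :
    hockeyStick a b L ≤ hockeyStick a b L' := by
  obtain ⟨Ω, Ω', _, _, P, Q, P', Q', _, _, _, _, rfl, rfl, φ, hφ, rfl, rfl⟩ := h
  refine hockeyStick_ofPair_le _ _ hb fun A hA => ?_
  rw [Measure.bind_apply hA φ.aemeasurable, Measure.bind_apply hA φ.aemeasurable]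
  exact mul_lintegral_le_add_hockeyStick P' Q' a b (φ.measurable_coe hA) fun ω => prob_le_one

theorem hockeyStick_mul (c a b : ℝ≥0∞) (hc : c ≠ ∞) (L : PLD) :
    hockeyStick (c * a) (c * b) L = c * hockeyStick a b L := by
  have := EReal.measurable_exp
  rw [hockeyStick, hockeyStick, ← lintegral_const_mul _ (by fun_prop)]
  refine lintegral_congr fun l => ?_
  rw [ENNReal.mul_sub (fun _ _ => hc), mul_assoc]

instance isProbabilityMeasure_coe (L : PLD) : IsProbabilityMeasure L.1 := by
  obtain ⟨_, Ω, _, P, Q, _, _, rfl⟩ := L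
  exact Measure.isProbabilityMeasure_map
    (ENNReal.measurable_log.comp (measurable_likelihoodRatio P Q)).aemeasurable

theorem exists_eq_ofPair (L : PLD) : ∃ (Ω : Type) (_ : MeasurableSpace Ω) (P Q : Measure Ω)
    (_ : IsProbabilityMeasure P) (_ : IsProbabilityMeasure Q), L = ofPair P Q := by
  obtain ⟨_, Ω, _, P, Q, hP, hQ, rfl⟩ := L
  exact ⟨Ω, _, P, Q, hP, hQ, rfl⟩

/-- Events have probability at most `1`, so changing a price by `c` changes `a P(A) - b Q(A)` by at
most `c`. The hypotheses are one-sided because the divergence increases in `a` and decreases in `b`.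
-/
theorem hockeyStick_le_add {a a' b b' c d : ℝ≥0∞} (hb : b ≠ ∞) (ha : a ≤ a' + c)
    (hb' : b' ≤ b + d) (L : PLD) :
    hockeyStick a b L ≤ hockeyStick a' b' L + (c + d) := by
  obtain ⟨Ω, _, P, Q, _, _, rfl⟩ := L.exists_eq_ofPair
  refine hockeyStick_ofPair_le P Q hb fun A hA => ?_
  calc a * P A ≤ (a' + c) * P A := by gcongr
    _ ≤ a' * P A + c := by rw [add_mul]; gcongr; exact mul_le_of_le_one_right' prob_le_one
    _ ≤ (b' * Q A + hockeyStick a' b' (ofPair P Q)) + c := by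
        gcongr; exact mul_measure_le_add_hockeyStick P Q a' b' hA
    _ ≤ ((b + d) * Q A + hockeyStick a' b' (ofPair P Q)) + c := by gcongr
    _ ≤ ((b * Q A + d) + hockeyStick a' b' (ofPair P Q)) + c := by
        rw [add_mul]; gcongr; exact mul_le_of_le_one_right' prob_le_one
    _ = _ := by ring

end PLD

/-! ### Standard representation of privacy loss distributions -/

/-- A measure on the unit interval is standard if it is the law under `P + Q` of the density of `P`
with respect to `P + Q`, for some pair of probability distributions. -/
class IsStandard (ν : Measure unitInterval) : Prop where
  lintegral_fst : ∫⁻ y : unitInterval, ENNReal.ofReal y ∂ν = 1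
  lintegral_snd : ∫⁻ y : unitInterval, ENNReal.ofReal (1 - y) ∂ν = 1

namespace IsStandard

theorem measurable_fst : Measurable fun y : unitInterval => ENNReal.ofReal y :=
  ENNReal.measurable_ofReal.comp measurable_subtype_coe

theorem measurable_snd : Measurable fun y : unitInterval => ENNReal.ofReal (1 - y) :=
  ENNReal.measurable_ofReal.comp (measurable_const.sub measurable_subtype_coe)

/-- The first distribution of the pair with a given standard measure. -/
noncomputable def fst (ν : Measure unitInterval) : Measure unitInterval :=
  ν.withDensity fun y => ENNReal.ofReal y

/-- The second distribution of the pair with a given standard measure. -/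
noncomputable def snd (ν : Measure unitInterval) : Measure unitInterval :=
  ν.withDensity fun y => ENNReal.ofReal (1 - y)

theorem measure_univ (ν : Measure unitInterval) [h : IsStandard ν] : ν Set.univ = 2 := by
  have h1 : ∫⁻ y : unitInterval, (ENNReal.ofReal (1 - y) + ENNReal.ofReal y) ∂ν = 1 + 1 := by
    rw [lintegral_add_left measurable_snd, h.lintegral_fst, h.lintegral_snd]
  rw [← one_add_one_eq_two, ← h1, ← lintegral_one]
  refine lintegral_congr fun y => ?_
  rw [← ENNReal.ofReal_add (sub_nonneg.2 y.2.2) y.2.1]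
  simp

variable (ν : Measure unitInterval) [h : IsStandard ν]

instance isFiniteMeasure : IsFiniteMeasure ν := ⟨by rw [measure_univ]; exact ENNReal.ofNat_lt_top⟩

instance isProbabilityMeasure_fst : IsProbabilityMeasure (fst ν) :=
  ⟨by rw [fst, withDensity_apply _ MeasurableSet.univ, setLIntegral_univ, h.lintegral_fst]⟩

instance isProbabilityMeasure_snd : IsProbabilityMeasure (snd ν) :=
  ⟨by rw [snd, withDensity_apply _ MeasurableSet.univ, setLIntegral_univ, h.lintegral_snd]⟩

theorem integrable_coe : Integrable (fun y : unitInterval => (y : ℝ)) ν :=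
  Integrable.of_bound continuous_subtype_val.aestronglyMeasurable 1
    (Filter.Eventually.of_forall fun y => by
      rw [Real.norm_eq_abs, abs_of_nonneg y.2.1]; exact y.2.2)

theorem integral_coe : ∫ y : unitInterval, (y : ℝ) ∂ν = 1 := by
  rw [integral_eq_lintegral_of_nonneg_ae (Filter.Eventually.of_forall fun y => y.2.1)
    continuous_subtype_val.aestronglyMeasurable, h.lintegral_fst, ENNReal.toReal_one]

theorem measureReal_univ : ν.real Set.univ = 2 := by
  rw [measureReal_def, measure_univ]; rfl

end IsStandard

namespace PLD

open IsStandard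

/-- The privacy loss distribution with a given standard measure. -/
noncomputable def ofStandard (ν : Measure unitInterval) [IsStandard ν] : PLD :=
  ofPair (IsStandard.fst ν) (IsStandard.snd ν)

theorem hockeyStick_ofStandard (ν : Measure unitInterval) [IsStandard ν] (a b : ℝ≥0∞) :
    hockeyStick a b (ofStandard ν) =
      ∫⁻ y : unitInterval, (a * ENNReal.ofReal y - b * ENNReal.ofReal (1 - y)) ∂ν :=
  hockeyStick_ofPair (P := IsStandard.fst ν) (Q := IsStandard.snd ν) IsStandard.measurable_fst
    IsStandard.measurable_snd rfl rfl a b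

/-- Hockey-stick divergences in terms of the potential of the standard measure. -/
theorem hockeyStick_ofStandard_eq_lintegral_sub (ν : Measure unitInterval) [IsStandard ν] {s : ℝ}
    (h0 : 0 ≤ s) (h1 : s ≤ 1) :
    hockeyStick (ENNReal.ofReal (1 - s)) (ENNReal.ofReal s) (ofStandard ν) =
      ∫⁻ y : unitInterval, ENNReal.ofReal (y - s) ∂ν := by
  rw [hockeyStick_ofStandard]
  refine lintegral_congr fun y => ?_
  rw [← ENNReal.ofReal_mul (sub_nonneg.2 h1), ← ENNReal.ofReal_mul h0, ← ENNReal.ofReal_sub _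
    (mul_nonneg h0 (sub_nonneg.2 y.2.2))]
  congr 1
  ring

/-- Every hockey-stick divergence is a multiple of one whose parameters add up to `1`. -/
theorem hockeyStick_eq_mul (a b : NNReal) (h : a + b ≠ 0) (L : PLD) :
    hockeyStick a b L = ((a + b : NNReal) : ℝ≥0∞) *
      hockeyStick (ENNReal.ofReal (1 - b / (a + b))) (ENNReal.ofReal (b / (a + b))) L := by
  have h' : (a + b : ℝ) ≠ 0 := by exact_mod_cast h
  have ha : (a : ℝ≥0∞) = ((a + b : NNReal) : ℝ≥0∞) * ENNReal.ofReal (1 - b / (a + b)) := by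
    rw [← ENNReal.ofReal_coe_nnreal (p := a + b), ← ENNReal.ofReal_mul (NNReal.coe_nonneg _),
      NNReal.coe_add, mul_sub, mul_div_cancel₀ _ h', mul_one, add_sub_cancel_right,
      ENNReal.ofReal_coe_nnreal]
  have hb : (b : ℝ≥0∞) = ((a + b : NNReal) : ℝ≥0∞) * ENNReal.ofReal (b / (a + b)) := by
    rw [← ENNReal.ofReal_coe_nnreal (p := a + b), ← ENNReal.ofReal_mul (NNReal.coe_nonneg _),
      NNReal.coe_add, mul_div_cancel₀ _ h', ENNReal.ofReal_coe_nnreal]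
  rw [← hockeyStick_mul _ _ _ ENNReal.coe_ne_top, ← ha, ← hb]

/-- The density `r` of `P` with respect to `P + Q` is a sufficient statistic: `Q` has density `1 -
r`, so the loss is `log (r / (1 - r))` and depends on `r` alone. -/
theorem exists_eq_ofStandard (L : PLD) :
    ∃ (ν : Measure unitInterval) (_ : IsStandard ν), L = ofStandard ν := by
  obtain ⟨Ω, _, P, Q, _, _, rfl⟩ := L.exists_eq_ofPair
  have mp := Measure.measurable_rnDeriv P (P + Q)
  have mq := Measure.measurable_rnDeriv Q (P + Q)
  have hPac : P ≪ P + Q := Measure.AbsolutelyContinuous.rfl.add_right Q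
  have hQac : Q ≪ P + Q := by
    rw [add_comm]; exact Measure.AbsolutelyContinuous.rfl.add_right P
  have hP := Measure.withDensity_rnDeriv_eq P (P + Q) hPac
  have hQ := Measure.withDensity_rnDeriv_eq Q (P + Q) hQac
  have hadd : (fun ω => P.rnDeriv (P + Q) ω + Q.rnDeriv (P + Q) ω) =ᵐ[P + Q] 1 := by
    refine (withDensity_eq_iff_of_sigmaFinite (mp.add mq).aemeasurable aemeasurable_one).1 ?_
    rw [withDensity_add_left mp, hP, hQ]
    exact withDensity_one.symm
  let r : Ω → unitInterval := fun ω =>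
    Set.projIcc 0 1 zero_le_one (P.rnDeriv (P + Q) ω).toReal
  have mr : Measurable r := continuous_projIcc.measurable.comp mp.ennreal_toReal
  have hr : ∀ᵐ ω ∂(P + Q), ENNReal.ofReal (r ω) = P.rnDeriv (P + Q) ω ∧
      ENNReal.ofReal (1 - r ω) = Q.rnDeriv (P + Q) ω := by
    filter_upwards [hadd] with ω hω
    have hω' : P.rnDeriv (P + Q) ω + Q.rnDeriv (P + Q) ω = 1 := hω
    have h1 : P.rnDeriv (P + Q) ω ≤ 1 := hω' ▸ le_self_add
    have h2 : P.rnDeriv (P + Q) ω ≠ ∞ := ne_top_of_le_ne_top ENNReal.one_ne_top h1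
    have h3 : ((r ω : unitInterval) : ℝ) = (P.rnDeriv (P + Q) ω).toReal := by
      simp only [r]
      rw [Set.projIcc_of_mem zero_le_one
        ⟨ENNReal.toReal_nonneg, by simpa using ENNReal.toReal_mono ENNReal.one_ne_top h1⟩]
    have h4 : ENNReal.ofReal (r ω) = P.rnDeriv (P + Q) ω := by rw [h3, ENNReal.ofReal_toReal h2]
    refine ⟨h4, ?_⟩
    rw [ENNReal.ofReal_sub _ (r ω).2.1, h4, ENNReal.ofReal_one, ← hω',
      ENNReal.add_sub_cancel_left h2]
  have mapP : IsStandard.fst ((P + Q).map r) = P.map r := by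
    ext B hB
    rw [IsStandard.fst, withDensity_apply _ hB, setLIntegral_map hB IsStandard.measurable_fst mr,
      Measure.map_apply mr hB]
    conv_rhs => rw [← hP]
    rw [withDensity_apply _ (mr hB)]
    exact lintegral_congr_ae (ae_restrict_of_ae (hr.mono fun ω h => h.1))
  have mapQ : IsStandard.snd ((P + Q).map r) = Q.map r := by
    ext B hB
    rw [IsStandard.snd, withDensity_apply _ hB, setLIntegral_map hB IsStandard.measurable_snd mr,
      Measure.map_apply mr hB]
    conv_rhs => rw [← hQ]
    rw [withDensity_apply _ (mr hB)]
    exact lintegral_congr_ae (ae_restrict_of_ae (hr.mono fun ω h => h.2))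
  have hstd : IsStandard ((P + Q).map r) := by
    constructor
    · rw [← setLIntegral_univ, ← withDensity_apply _ MeasurableSet.univ]
      change IsStandard.fst _ _ = _
      rw [mapP, Measure.map_apply mr MeasurableSet.univ]
      simp
    · rw [← setLIntegral_univ, ← withDensity_apply _ MeasurableSet.univ]
      change IsStandard.snd _ _ = _
      rw [mapQ, Measure.map_apply mr MeasurableSet.univ]
      simp
  refine ⟨_, hstd, Subtype.ext ?_⟩
  change pldMeasure P Q = pldMeasure _ _
  rw [pldMeasure_eq_map (P := IsStandard.fst _) (Q := IsStandard.snd _) (ν := (P + Q).map r)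
    IsStandard.measurable_fst IsStandard.measurable_snd rfl rfl, mapP, Measure.map_map _ mr,
    pldMeasure]
  · refine Measure.map_congr ?_
    filter_upwards [hPac.ae_le hr] with ω hω
    rw [Function.comp, hω.1, hω.2, likelihoodRatio]
  · exact ENNReal.measurable_log.comp (IsStandard.measurable_fst.div IsStandard.measurable_snd)

/-- The potential of a standard measure controls the integrals of all convex functions. -/
theorem integral_le_of_lintegral_sub_le {ν ν' : Measure unitInterval} [IsStandard ν]
    [IsStandard ν']
    (h : ∀ s : ℝ, 0 ≤ s → s ≤ 1 → ∫⁻ y : unitInterval, ENNReal.ofReal (y - s) ∂ν ≤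
      ∫⁻ y : unitInterval, ENNReal.ofReal (y - s) ∂ν') {f : ℝ → ℝ}
    (hf : ConvexOn ℝ Set.univ f) :
    ∫ y : unitInterval, f y ∂ν ≤ ∫ y : unitInterval, f y ∂ν' := by
  obtain ⟨F, -, hF⟩ := hf.exists_stieltjesFunction
  have hfc : Continuous f := by
    rw [← continuousOn_univ]
    exact hf.continuousOn isOpen_univ
  -- Without its supporting line at `0`, `f` is on `[0,1]` the mixture of the hinges `max (y - s) 0`
  -- with weights `dF(s)`.
  let r : ℝ → ℝ := fun y => f y - f 0 - F 0 * y
  have hrc : Continuous fun y : unitInterval => r y := by fun_prop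
  have hT : ∀ y : unitInterval,
      ∫⁻ s in Set.Ioc 0 1, ENNReal.ofReal (y - s) ∂F.measure = ENNReal.ofReal (r y) := fun y => by
    rw [F.lintegral_ofReal_sub y.2.1 y.2.2, hF _ _ y.2.1, sub_zero]
  have hr0 : ∀ y : unitInterval, 0 ≤ r y := fun y => by
    have h1 : ∫ t in (0 : ℝ)..y, F 0 ≤ ∫ t in (0 : ℝ)..y, F t :=
      intervalIntegral.integral_mono_on y.2.1 (by simp) F.mono.intervalIntegrable
        fun t ht => F.mono ht.1
    rw [hF _ _ y.2.1, intervalIntegral.integral_const, sub_zero, smul_eq_mul] at h1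
    simp only [r]
    linarith
  have hint : ∀ (ρ : Measure unitInterval) [IsFiniteMeasure ρ] (g : unitInterval → ℝ),
      Continuous g → Integrable g ρ := fun ρ _ g hg => by
    let g' : C(unitInterval, ℝ) := ⟨g, hg⟩
    exact Integrable.of_bound hg.aestronglyMeasurable ‖g'‖
      (Filter.Eventually.of_forall g'.norm_coe_le_norm)
  have hswap : ∀ (ρ : Measure unitInterval) [IsFiniteMeasure ρ],
      ∫⁻ y : unitInterval, ENNReal.ofReal (r y) ∂ρ =
        ∫⁻ s in Set.Ioc 0 1, ∫⁻ y : unitInterval, ENNReal.ofReal (y - s) ∂ρ ∂F.measure := by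
    intro ρ _
    rw [← lintegral_lintegral_swap]
    · exact lintegral_congr fun y => (hT y).symm
    · exact Measurable.aemeasurable (by fun_prop)
  have hr : ∫ y : unitInterval, r y ∂ν ≤ ∫ y : unitInterval, r y ∂ν' := by
    rw [integral_eq_lintegral_of_nonneg_ae (Filter.Eventually.of_forall hr0)
      hrc.aestronglyMeasurable, integral_eq_lintegral_of_nonneg_ae
      (Filter.Eventually.of_forall hr0) hrc.aestronglyMeasurable]
    refine ENNReal.toReal_mono (hint ν' _ hrc).lintegral_lt_top.ne ?_
    rw [hswap, hswap]
    exact setLIntegral_mono' measurableSet_Ioc fun s hs => h s hs.1.le hs.2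
  -- All standard measures have mass `2` and first moment `1`, so the affine part integrates to the
  -- same constant.
  have hdec : ∀ (ρ : Measure unitInterval) [IsStandard ρ],
      ∫ y : unitInterval, f y ∂ρ = ∫ y : unitInterval, r y ∂ρ + (2 * f 0 + F 0) := by
    intro ρ _
    have : ∀ y : unitInterval, f y = r y + (f 0 + F 0 * y) := fun y => by simp only [r]; ring
    simp only [this]
    rw [integral_add (hint ρ _ hrc) (hint ρ _ (by fun_prop)),
      integral_add (integrable_const _) ((integrable_coe ρ).const_mul _), integral_const,
      integral_const_mul, integral_coe, measureReal_univ, smul_eq_mul, mul_one]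
  rw [hdec, hdec]
  linarith

/-- The potential of a standard measure determines it. -/
theorem eq_of_lintegral_sub_eq {ν ν' : Measure unitInterval} [IsStandard ν] [IsStandard ν']
    (h : ∀ s : ℝ, 0 ≤ s → s ≤ 1 → ∫⁻ y : unitInterval, ENNReal.ofReal (y - s) ∂ν =
      ∫⁻ y : unitInterval, ENNReal.ofReal (y - s) ∂ν') : ν = ν' := by
  -- Exponentials are convex, so equal potentials already force equal moment generating functions,
  -- which determine a measure on `[0,1]`.
  have hexp : ∀ t : ℝ, ConvexOn ℝ Set.univ fun y => Real.exp (t * y) := fun t =>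
    convexOn_exp.comp_linearMap (LinearMap.mulLeft ℝ t)
  have hmgf : mgf (Subtype.val : unitInterval → ℝ) ν = mgf Subtype.val ν' := funext fun t =>
    le_antisymm (integral_le_of_lintegral_sub_le (fun s h0 h1 => (h s h0 h1).le) (hexp t))
      (integral_le_of_lintegral_sub_le (fun s h0 h1 => (h s h0 h1).ge) (hexp t))
  have hset : integrableExpSet (Subtype.val : unitInterval → ℝ) ν = Set.univ := by
    refine Set.eq_univ_of_forall fun t => ?_
    let g : C(unitInterval, ℝ) := ⟨fun y => Real.exp (t * y), by fun_prop⟩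
    exact Integrable.of_bound g.continuous.aestronglyMeasurable ‖g‖
      (Filter.Eventually.of_forall g.norm_coe_le_norm)
  have hzero : ∀ (ρ : Measure unitInterval) [IsStandard ρ], ρ ≠ 0 := fun ρ _ h0 => by
    have := IsStandard.measure_univ ρ
    simp [h0] at this
  have hc : complexMGF (Subtype.val : unitInterval → ℝ) ν = complexMGF Subtype.val ν' := by
    funext z
    refine eqOn_complexMGF_of_mgf' hmgf (iff_of_false (hzero ν) (hzero ν')) ?_
    rw [hset]
    simp
  have hmap := Measure.ext_of_complexMGF_eq measurable_subtype_coe.aemeasurable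
    measurable_subtype_coe.aemeasurable hc
  have hemb : MeasurableEmbedding (Subtype.val : unitInterval → ℝ) :=
    MeasurableEmbedding.subtype_coe measurableSet_Icc
  rw [← hemb.comap_map ν, hmap, hemb.comap_map]

end PLD

/-! ### Blackwell's theorem -/

namespace PLD

/-- Pushing a density through a disintegrated coupling. -/
theorem map_snd_withDensity_comp_fst {X Y : Type*} [MeasurableSpace X] [MeasurableSpace Y]
    (μ : Measure X) [SFinite μ] (φ : Kernel X Y) [IsSFiniteKernel φ] {d : X → ℝ≥0∞}
    (hd : Measurable d) :
    ((μ.compProd φ).withDensity fun z => d z.1).map Prod.snd = (μ.withDensity d).bind φ := by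
  ext B hB
  rw [Measure.map_apply measurable_snd hB, withDensity_apply _ (measurable_snd hB),
    Measure.bind_apply hB φ.aemeasurable,
    lintegral_withDensity_eq_lintegral_mul _ hd (φ.measurable_coe hB),
    ← lintegral_indicator (measurable_snd hB), Measure.lintegral_compProd]
  · refine lintegral_congr fun x => ?_
    rw [Pi.mul_apply, ← lintegral_indicator_const hB]
    rfl
  · exact (hd.comp measurable_fst).indicator (measurable_snd hB)

theorem map_fst_withDensity_comp_fst {X Y : Type*} [MeasurableSpace X] [MeasurableSpace Y]
    (π : Measure (X × Y)) {d : X → ℝ≥0∞} (hd : Measurable d) :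
    (π.withDensity fun z => d z.1).map Prod.fst = (π.map Prod.fst).withDensity d := by
  ext B hB
  rw [Measure.map_apply measurable_fst hB, withDensity_apply _ (measurable_fst hB),
    withDensity_apply _ hB, setLIntegral_map hB hd measurable_fst]

/-- A standard measure that is dominated in convex order arises by post-processing. -/
theorem blackwellLE_of_integral_le {ν ν' : Measure unitInterval} [IsStandard ν] [IsStandard ν']
    (h : ∀ f : ℝ → ℝ, ConvexOn ℝ Set.univ f → ∫ x : unitInterval, f x ∂ν ≤
      ∫ x : unitInterval, f x ∂ν') :
    BlackwellLE (IsStandard.fst ν) (IsStandard.snd ν) (IsStandard.fst ν') (IsStandard.snd ν') := by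
  obtain ⟨π, _, h1, h2, h3⟩ := exists_martingale_coupling ν ν' h
  have e1 : π.map Prod.fst = ν := by
    refine ext_of_forall_integral_eq_of_IsFiniteMeasure fun f => ?_
    rw [integral_map measurable_fst.aemeasurable f.continuous.aestronglyMeasurable]
    exact h1 f.toContinuousMap
  have e2 : π.map Prod.snd = ν' := by
    refine ext_of_forall_integral_eq_of_IsFiniteMeasure fun f => ?_
    rw [integral_map measurable_snd.aemeasurable f.continuous.aestronglyMeasurable]
    exact h2 f.toContinuousMap
  have hswap : (π.map Prod.swap).fst = ν' := by rw [Measure.fst_map_swap]; exact e2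
  have hdis : ν'.compProd (π.map Prod.swap).condKernel = π.map Prod.swap := by
    rw [← hswap]; exact (π.map Prod.swap).disintegrate _
  have hint : ∀ f : C(unitInterval × unitInterval, ℝ), Integrable f π := fun f =>
    Integrable.of_bound f.continuous.aestronglyMeasurable ‖f‖
      (Filter.Eventually.of_forall f.norm_coe_le_norm)
  -- The kernel is the conditional law of the first coordinate given the second. It carries `d ν'`
  -- to `d ν` whenever `E[d(Y) | X] = d(X)`; the martingale property gives this for `d(y) = y` and
  -- `d(y) = 1 - y`.
  have key : ∀ d : unitInterval → ℝ, Continuous d → (∀ y, 0 ≤ d y) →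
      (∀ g : C(unitInterval, ℝ), ∫ z, d z.2 * g z.1 ∂π = ∫ z, d z.1 * g z.1 ∂π) →
      ν.withDensity (fun y => ENNReal.ofReal (d y)) =
        (ν'.withDensity fun y => ENNReal.ofReal (d y)).bind (π.map Prod.swap).condKernel := by
    intro d hd hd0 hdg
    have hm : Measurable fun y => ENNReal.ofReal (d y) := by fun_prop
    have : IsFiniteMeasure (π.withDensity fun z => ENNReal.ofReal (d z.1)) :=
      isFiniteMeasure_withDensity_ofReal (hint ⟨fun z => d z.1, by fun_prop⟩).2
    have : IsFiniteMeasure (π.withDensity fun z => ENNReal.ofReal (d z.2)) :=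
      isFiniteMeasure_withDensity_ofReal (hint ⟨fun z => d z.2, by fun_prop⟩).2
    rw [← map_snd_withDensity_comp_fst _ _ hm, hdis, ← e1, ← map_fst_withDensity_comp_fst _ hm]
    have hm1 : Measurable fun z : unitInterval × unitInterval => ENNReal.ofReal (d z.1) :=
      hm.comp measurable_fst
    have hs : ((π.map Prod.swap).withDensity fun z => ENNReal.ofReal (d z.1)).map Prod.snd =
        (π.withDensity fun z => ENNReal.ofReal (d z.2)).map Prod.fst := by
      ext B hB
      rw [Measure.map_apply measurable_snd hB, withDensity_apply _ (measurable_snd hB),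
        setLIntegral_map (measurable_snd hB) hm1 measurable_swap,
        Measure.map_apply measurable_fst hB, withDensity_apply _ (measurable_fst hB)]
      rfl
    rw [hs]
    refine ext_of_forall_integral_eq_of_IsFiniteMeasure fun f => ?_
    rw [integral_map measurable_fst.aemeasurable f.continuous.aestronglyMeasurable,
      integral_map measurable_fst.aemeasurable f.continuous.aestronglyMeasurable,
      integral_withDensity_eq_integral_toReal_smul (by fun_prop)
        (Filter.Eventually.of_forall fun _ => ENNReal.ofReal_lt_top),
      integral_withDensity_eq_integral_toReal_smul (by fun_prop)
        (Filter.Eventually.of_forall fun _ => ENNReal.ofReal_lt_top)]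
    simp only [ENNReal.toReal_ofReal (hd0 _), smul_eq_mul]
    exact (hdg f.toContinuousMap).symm
  have hint1 : ∀ g : C(unitInterval, ℝ), Integrable (fun z => (z.1 : ℝ) * g z.1) π := fun g =>
    hint ⟨fun z => (z.1 : ℝ) * g z.1, by fun_prop⟩
  have hint2 : ∀ g : C(unitInterval, ℝ), Integrable (fun z => (z.2 : ℝ) * g z.1) π := fun g =>
    hint ⟨fun z => (z.2 : ℝ) * g z.1, by fun_prop⟩
  have hint0 : ∀ g : C(unitInterval, ℝ), Integrable (fun z => g z.1) π := fun g =>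
    hint ⟨fun z => g z.1, by fun_prop⟩
  have hg : ∀ g : C(unitInterval, ℝ),
      ∫ z, (z.2 : ℝ) * g z.1 ∂π = ∫ z, (z.1 : ℝ) * g z.1 ∂π := fun g => by
    rw [← sub_eq_zero, ← integral_sub (hint2 g) (hint1 g), ← h3 g]
    exact integral_congr_ae (Filter.Eventually.of_forall fun z => by ring)
  refine ⟨(π.map Prod.swap).condKernel, inferInstance,
    key Subtype.val continuous_subtype_val (fun y => y.2.1) hg,
    key (fun y => 1 - y) (by fun_prop) (fun y => sub_nonneg.2 y.2.2) fun g => ?_⟩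
  simp only [sub_mul, one_mul]
  rw [integral_sub (hint0 g) (hint2 g), integral_sub (hint0 g) (hint1 g), hg]

theorem lintegral_sub_le_of_hockeyStick_le {ν ν' : Measure unitInterval} [IsStandard ν]
    [IsStandard ν'] (h : ∀ a b : NNReal, hockeyStick a b (ofStandard ν) ≤
      hockeyStick a b (ofStandard ν')) {s : ℝ} (h0 : 0 ≤ s) (h1 : s ≤ 1) :
    ∫⁻ y : unitInterval, ENNReal.ofReal (y - s) ∂ν ≤
      ∫⁻ y : unitInterval, ENNReal.ofReal (y - s) ∂ν' := by
  rw [← hockeyStick_ofStandard_eq_lintegral_sub ν h0 h1,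
    ← hockeyStick_ofStandard_eq_lintegral_sub ν' h0 h1]
  exact h _ _

/-- Blackwell's theorem: the order is given by comparing all hockey-stick divergences. -/
theorem le_iff_hockeyStick_le {L L' : PLD} :
    L ≤ L' ↔ ∀ a b : NNReal, hockeyStick a b L ≤ hockeyStick a b L' := by
  refine ⟨fun h a b => hockeyStick_mono h ENNReal.coe_ne_top, fun h => ?_⟩
  obtain ⟨ν, _, rfl⟩ := L.exists_eq_ofStandard
  obtain ⟨ν', _, rfl⟩ := L'.exists_eq_ofStandard
  exact ⟨unitInterval, unitInterval, _, _, _, _, _, _, inferInstance, inferInstance, inferInstance,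
    inferInstance, rfl, rfl, blackwellLE_of_integral_le fun f hf =>
      integral_le_of_lintegral_sub_le (fun s h0 h1 => lintegral_sub_le_of_hockeyStick_le h h0 h1)
        hf⟩

/-- The potential determines the standard measure and hence the PLD. This is the source of
antisymmetry, which is not visible from an order defined through representing pairs. -/
theorem eq_of_hockeyStick_eq {L L' : PLD}
    (h : ∀ a b : NNReal, hockeyStick a b L = hockeyStick a b L') : L = L' := by
  obtain ⟨ν, _, rfl⟩ := L.exists_eq_ofStandard
  obtain ⟨ν', _, rfl⟩ := L'.exists_eq_ofStandard
  obtain rfl : ν = ν' := eq_of_lintegral_sub_eq fun s h0 h1 => le_antisymm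
    (lintegral_sub_le_of_hockeyStick_le (fun a b => (h a b).le) h0 h1)
    (lintegral_sub_le_of_hockeyStick_le (fun a b => (h a b).ge) h0 h1)
  rfl

theorem le_antisymm' {L L' : PLD} (h : L ≤ L') (h' : L' ≤ L) : L = L' :=
  eq_of_hockeyStick_eq fun a b =>
    le_antisymm (le_iff_hockeyStick_le.1 h a b) (le_iff_hockeyStick_le.1 h' a b)

/-- Antisymmetry makes the choice inside `sup` immaterial. -/
theorem sup_eq_of_isLUB {A : Set PLD} {S : PLD} (h : IsLUB A S) : sup A = S := by
  have hA : ∃ S, IsLUB A S := ⟨S, h⟩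
  rw [sup, dif_pos hA]
  exact le_antisymm' (hA.choose_spec.2 h.1) (h.2 hA.choose_spec.1)

theorem isLUB_of_hockeyStick_eq_iSup {A : Set PLD} {S : PLD}
    (h : ∀ a b : NNReal, hockeyStick a b S = ⨆ L ∈ A, hockeyStick a b L) : IsLUB A S := by
  refine ⟨fun L hL => le_iff_hockeyStick_le.2 fun a b => ?_, fun U hU =>
    le_iff_hockeyStick_le.2 fun a b => ?_⟩
  · rw [h]
    exact le_iSup₂ (f := fun L (_ : L ∈ A) => hockeyStick (a : ℝ≥0∞) b L) L hL
  · rw [h]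
    exact iSup₂_le fun L hL => le_iff_hockeyStick_le.1 (hU hL) a b

end PLD

/-! ### Existence of suprema -/

/-- A convex function with the right behaviour outside of `[0, 1]` is the potential of a standard
measure. -/
theorem exists_isStandard_of_convexOn {g : ℝ → ℝ} (hg : ConvexOn ℝ Set.univ g)
    (h0 : ∀ y ≤ 0, g y = 0) (h1 : ∀ y, 1 ≤ y → g y = 2 * y - 1) :
    ∃ (ν : Measure unitInterval) (_ : IsStandard ν), ∀ s : ℝ, 0 ≤ s → s ≤ 1 →
      ∫⁻ y : unitInterval, ENNReal.ofReal (y - s) ∂ν = ENNReal.ofReal (g (1 - s)) := by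
  obtain ⟨F, hF, hint⟩ := hg.exists_stieltjesFunction
  have hd0 : ∀ t < 0, derivWithin g (Set.Ioi t) t = 0 := fun t ht => by
    have : g =ᶠ[nhds t] fun _ => 0 := by
      filter_upwards [Iio_mem_nhds ht] with y hy
      exact h0 y (le_of_lt hy)
    exact (((hasDerivAt_const t (0 : ℝ)).congr_of_eventuallyEq this).hasDerivWithinAt).derivWithin
      (uniqueDiffWithinAt_Ioi t)
  have hd1 : ∀ t, 1 < t → derivWithin g (Set.Ioi t) t = 2 := fun t ht => by
    have : g =ᶠ[nhds t] fun y => 2 * y - 1 := by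
      filter_upwards [Ioi_mem_nhds ht] with y hy
      exact h1 y (le_of_lt hy)
    have hd : HasDerivAt (fun y : ℝ => 2 * y - 1) 2 t := by
      simpa using ((hasDerivAt_id t).const_mul 2).sub_const 1
    exact ((hd.congr_of_eventuallyEq this).hasDerivWithinAt).derivWithin
      (uniqueDiffWithinAt_Ioi t)
  have hF0 : F (-1) = 0 := by
    rw [hF]
    refine rightLim_eq_of_tendsto (tendsto_const_nhds.congr' ?_)
    filter_upwards [Ioo_mem_nhdsGT (show (-1 : ℝ) < 0 by norm_num)] with t ht
    exact (hd0 t ht.2).symm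
  have hF1 : F 1 = 2 := by
    rw [hF]
    refine rightLim_eq_of_tendsto (tendsto_const_nhds.congr' ?_)
    filter_upwards [self_mem_nhdsWithin] with t ht
    exact (hd1 t ht).symm
  -- Starting at `-1` rather than `0` keeps a possible atom of the second derivative at `0`.
  set μ := F.measure.restrict (Set.Ioc (-1) 1)
  have hT : ∀ y : ℝ, -1 ≤ y → y ≤ 1 → ∫⁻ s, ENNReal.ofReal (y - s) ∂μ = ENNReal.ofReal (g y) := by
    intro y hy0 hy1
    rw [F.lintegral_ofReal_sub hy0 hy1, hint _ _ hy0, hF0, h0 (-1) (by norm_num)]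
    simp
  -- The potential of `μ` at `0` is `g 0 = 0`, which leaves no mass on the negative axis.
  have hμ0 : ∀ᵐ s ∂μ, 0 ≤ s := by
    have := hT 0 (by norm_num) (by norm_num)
    rw [h0 0 le_rfl, ENNReal.ofReal_zero, lintegral_eq_zero_iff (by fun_prop)] at this
    filter_upwards [this] with s hs
    simpa using hs
  have hμ1 : ∀ᵐ s ∂μ, s ≤ 1 := by
    filter_upwards [ae_restrict_mem measurableSet_Ioc] with s hs
    exact hs.2
  have hμ : μ Set.univ = 2 := by
    rw [Measure.restrict_apply_univ, F.measure_Ioc, hF0, hF1]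
    simp
  -- Undoes the reflection `s ↦ 1 - s` between `g` and the potential; the projection onto the
  -- interval acts trivially almost everywhere.
  let r : ℝ → unitInterval := fun s => Set.projIcc 0 1 zero_le_one (1 - s)
  have hr : Measurable r := (continuous_projIcc.comp (by fun_prop)).measurable
  have hU : ∀ s : ℝ, 0 ≤ s → s ≤ 1 →
      ∫⁻ y : unitInterval, ENNReal.ofReal (y - s) ∂(μ.map r) = ENNReal.ofReal (g (1 - s)) := by
    intro s hs0 hs1
    rw [lintegral_map (by fun_prop) hr, ← hT (1 - s) (by linarith) (by linarith)]
    refine lintegral_congr_ae ?_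
    filter_upwards [hμ0, hμ1] with t ht0 ht1
    simp only [r]
    rw [Set.projIcc_of_mem zero_le_one ⟨by linarith, by linarith⟩]
    congr 1
    simp only
    ring
  have hfst : ∫⁻ y : unitInterval, ENNReal.ofReal y ∂(μ.map r) = 1 := by
    have := hU 0 le_rfl zero_le_one
    simp only [sub_zero] at this
    rw [this, h1 1 le_rfl]
    norm_num
  refine ⟨μ.map r, ⟨hfst, ?_⟩, hU⟩
  have hsum : ∫⁻ y : unitInterval, ENNReal.ofReal y ∂(μ.map r) +
      ∫⁻ y : unitInterval, ENNReal.ofReal (1 - y) ∂(μ.map r) = 2 := by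
    rw [← lintegral_add_left IsStandard.measurable_fst, ← hμ, ← Set.preimage_univ (f := r),
      ← Measure.map_apply hr MeasurableSet.univ, ← lintegral_one]
    refine lintegral_congr fun y => ?_
    rw [← ENNReal.ofReal_add y.2.1 (sub_nonneg.2 y.2.2)]
    simp
  rw [hfst, ← one_add_one_eq_two] at hsum
  exact (ENNReal.add_right_inj ENNReal.one_ne_top).1 hsum

namespace PLD

/-- Nonempty sets of privacy loss distributions have suprema, and hockey-stick divergences of
suprema are suprema of hockey-stick divergences. -/
theorem exists_hockeyStick_eq_iSup {A : Set PLD} (hA : A.Nonempty) :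
    ∃ S : PLD, ∀ a b : NNReal, hockeyStick a b S = ⨆ L ∈ A, hockeyStick a b L := by
  have : Nonempty A := hA.to_subtype
  choose ν hν hL using exists_eq_ofStandard
  -- The potential at `1 - y`. Outside `(0,1)` it is the same for all PLDs, so the supremum over `L`
  -- has the correct ends.
  let U : PLD → ℝ → ℝ := fun L y => ∫ x : unitInterval, max (x - (1 - y)) 0 ∂(ν L)
  have hint : ∀ L y, Integrable (fun x : unitInterval => max ((x : ℝ) - (1 - y)) 0) (ν L) :=
    fun L y => by
      have := hν L
      let g' : C(unitInterval, ℝ) := ⟨fun x => max ((x : ℝ) - (1 - y)) 0, by fun_prop⟩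
      exact Integrable.of_bound g'.continuous.aestronglyMeasurable ‖g'‖
        (Filter.Eventually.of_forall g'.norm_coe_le_norm)
  have hbdd : ∀ y, BddAbove (Set.range fun L : A => U L y) := fun y => by
    refine ⟨2 * (1 + |y|), ?_⟩
    rintro _ ⟨L, rfl⟩
    have := hν L
    have h := integral_mono (hint L y) (integrable_const (1 + |y|)) fun x => by
      have h1 := x.2.2
      have h2 := le_abs_self y
      have h3 := abs_nonneg y
      exact max_le (by linarith) (by linarith)
    rwa [integral_const, IsStandard.measureReal_univ, smul_eq_mul] at h
  let g : ℝ → ℝ := fun y => ⨆ L : A, U L y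
  have hconv : ConvexOn ℝ Set.univ g := by
    refine ⟨convex_univ, fun y _ z _ a b ha hb hab => ciSup_le fun L => ?_⟩
    have h1 := le_ciSup (hbdd y) L
    have h2 := le_ciSup (hbdd z) L
    refine le_trans ?_ (add_le_add (mul_le_mul_of_nonneg_left h1 ha)
      (mul_le_mul_of_nonneg_left h2 hb))
    simp only [U]
    rw [← integral_const_mul, ← integral_const_mul, ← integral_add ((hint _ _).const_mul _)
      ((hint _ _).const_mul _)]
    refine integral_mono (hint _ _) (((hint _ _).const_mul _).add ((hint _ _).const_mul _))
      fun x => ?_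
    simp only [smul_eq_mul]
    have e : (x : ℝ) - (1 - (a * y + b * z)) = a * (x - (1 - y)) + b * (x - (1 - z)) := by
      linear_combination (1 - (x : ℝ)) * hab
    rw [e]
    refine max_le (add_le_add ?_ ?_) (add_nonneg ?_ ?_)
    · exact mul_le_mul_of_nonneg_left (le_max_left _ _) ha
    · exact mul_le_mul_of_nonneg_left (le_max_left _ _) hb
    · exact mul_nonneg ha (le_max_right _ _)
    · exact mul_nonneg hb (le_max_right _ _)
  obtain ⟨ρ, hρ, hρU⟩ := exists_isStandard_of_convexOn hconv
    (fun y hy => by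
      have : ∀ L : A, U L y = 0 := fun L => by
        have h : ∀ x : unitInterval, max ((x : ℝ) - (1 - y)) 0 = 0 := fun x => by
          have := x.2.2
          exact max_eq_right (by linarith)
        simp only [U, h, integral_zero]
      simp only [g, this, ciSup_const])
    (fun y hy => by
      have : ∀ L : A, U L y = 2 * y - 1 := fun L => by
        have := hν L
        have h : ∀ x : unitInterval, max ((x : ℝ) - (1 - y)) 0 = x - (1 - y) := fun x => by
          have := x.2.1
          exact max_eq_left (by linarith)
        simp only [U, h]
        rw [integral_sub (IsStandard.integrable_coe _) (integrable_const _), integral_const,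
          IsStandard.integral_coe, IsStandard.measureReal_univ, smul_eq_mul]
        ring
      simp only [g, this, ciSup_const])
  have hUL : ∀ L s, 0 ≤ s → s ≤ 1 → hockeyStick (ENNReal.ofReal (1 - s)) (ENNReal.ofReal s) L =
      ENNReal.ofReal (U L (1 - s)) := fun L s h0 h1 => by
    have := hν L
    conv_lhs => rw [hL L]
    rw [hockeyStick_ofStandard_eq_lintegral_sub _ h0 h1,
      ofReal_integral_eq_lintegral_ofReal (hint L _)
        (Filter.Eventually.of_forall fun x => le_max_right _ _)]
    refine lintegral_congr fun x => ?_
    rw [sub_sub_cancel, ENNReal.ofReal_max, ENNReal.ofReal_zero, max_eq_left zero_le]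
  have hkey : ∀ s : ℝ, 0 ≤ s → s ≤ 1 →
      hockeyStick (ENNReal.ofReal (1 - s)) (ENNReal.ofReal s) (ofStandard ρ) =
        ⨆ L ∈ A, hockeyStick (ENNReal.ofReal (1 - s)) (ENNReal.ofReal s) L := by
    intro s h0 h1
    rw [hockeyStick_ofStandard_eq_lintegral_sub _ h0 h1, hρU s h0 h1, iSup_subtype']
    simp only [hUL _ s h0 h1, g]
    exact ENNReal.ofReal_mono.map_ciSup_of_continuousAt ENNReal.continuous_ofReal.continuousAt
      (hbdd _)
  refine ⟨ofStandard ρ, fun a b => ?_⟩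
  by_cases hab : a + b = 0
  · obtain ⟨rfl, rfl⟩ := add_eq_zero.1 hab
    simp [hockeyStick]
  · have hs0 : (0 : ℝ) ≤ b / (a + b) := by positivity
    have hs1 : (b : ℝ) / (a + b) ≤ 1 := div_le_one_of_le₀ (by simp) (by positivity)
    rw [hockeyStick_eq_mul a b hab, hkey _ hs0 hs1, ENNReal.mul_iSup]
    refine iSup_congr fun L => ?_
    rw [ENNReal.mul_iSup, ← hockeyStick_eq_mul a b hab]

theorem isLUB_sup {A : Set PLD} (hA : A.Nonempty) : IsLUB A (sup A) := by
  obtain ⟨S, hS⟩ := exists_hockeyStick_eq_iSup hA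
  have h := isLUB_of_hockeyStick_eq_iSup hS
  rwa [sup_eq_of_isLUB h]

theorem hockeyStick_sup {A : Set PLD} (hA : A.Nonempty) (a b : NNReal) :
    hockeyStick a b (sup A) = ⨆ L ∈ A, hockeyStick a b L := by
  obtain ⟨S, hS⟩ := exists_hockeyStick_eq_iSup hA
  rw [sup_eq_of_isLUB (isLUB_of_hockeyStick_eq_iSup hS), hS]

end PLD

/-! ### Composition -/

namespace PLD

theorem ofPair_congr {Ω : Type} [MeasurableSpace Ω] {P Q P' Q' : Measure Ω}
    [IsProbabilityMeasure P] [IsProbabilityMeasure Q] [IsProbabilityMeasure P']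
    [IsProbabilityMeasure Q'] (hP : P = P') (hQ : Q = Q') : ofPair P Q = ofPair P' Q' := by
  subst hP hQ
  rfl

theorem conv_id (L : PLD) : L.conv id = L :=
  Subtype.ext (Measure.conv_dirac_zero L.1)

/-- `dP` is positive `P`-almost everywhere. In `hockeyStick_conv` this excludes a loss `⊤` meeting a
loss `⊥`, where the inverse of the product `∞ * 0` is not the product of the inverses. -/
theorem ae_ne_bot (L : PLD) : ∀ᵐ l ∂L.1, l ≠ ⊥ := by
  obtain ⟨ν, _, rfl⟩ := L.exists_eq_ofStandard
  have hd : (ofStandard ν).1 = (IsStandard.fst ν).map fun y : unitInterval =>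
      ENNReal.log (ENNReal.ofReal y / ENNReal.ofReal (1 - y)) :=
    pldMeasure_eq_map (P := IsStandard.fst ν) (Q := IsStandard.snd ν) IsStandard.measurable_fst
      IsStandard.measurable_snd rfl rfl
  have hlog : Measurable fun y : unitInterval =>
      ENNReal.log (ENNReal.ofReal y / ENNReal.ofReal (1 - y)) :=
    ENNReal.measurable_log.comp (IsStandard.measurable_fst.div IsStandard.measurable_snd)
  have hset : MeasurableSet {l : EReal | l ≠ ⊥} := (measurableSet_singleton _).compl
  rw [hd, ae_map_iff hlog.aemeasurable hset, IsStandard.fst,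
    ae_withDensity_iff IsStandard.measurable_fst]
  refine Filter.Eventually.of_forall fun y hy => ?_
  rw [Ne, ENNReal.log_eq_bot_iff, ENNReal.div_eq_zero_iff, not_or]
  exact ⟨hy, ENNReal.ofReal_ne_top⟩

/-- The hockey-stick divergence of a convolution, by conditioning on the first component. -/
theorem hockeyStick_conv {Ω : Type} [MeasurableSpace Ω] {P Q ν : Measure Ω}
    [IsProbabilityMeasure P] [IsProbabilityMeasure Q] [SigmaFinite ν] {p q : Ω → ℝ≥0∞}
    (hp : Measurable p) (hq : Measurable q)
    (hP : P = ν.withDensity p) (hQ : Q = ν.withDensity q) (a b : ℝ≥0∞) (S : PLD) :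
    hockeyStick a b ((ofPair P Q).conv S) = ∫⁻ ω, hockeyStick (a * p ω) (b * q ω) S ∂ν := by
  have pfin : ∀ᵐ ω ∂ν, p ω < ∞ := by
    refine ae_lt_top hp ?_
    rw [← setLIntegral_univ, ← withDensity_apply _ MeasurableSet.univ, ← hP]
    exact measure_ne_top _ _
  have qfin : ∀ᵐ ω ∂ν, q ω < ∞ := by
    refine ae_lt_top hq ?_
    rw [← setLIntegral_univ, ← withDensity_apply _ MeasurableSet.univ, ← hQ]
    exact measure_ne_top _ _
  have hexp := EReal.measurable_exp
  have hm : Measurable fun l : EReal => a - b * (EReal.exp l)⁻¹ := by fun_prop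
  have hm2 : Measurable fun l : EReal => ∫⁻ s, (a - b * (EReal.exp (l + s))⁻¹) ∂S.1 :=
    Measurable.lintegral_prod_right (f := fun l s : EReal => a - b * (EReal.exp (l + s))⁻¹)
      (hm.comp measurable_add)
  have hlog : Measurable fun ω => ENNReal.log (p ω / q ω) :=
    ENNReal.measurable_log.comp (hp.div hq)
  have hm3 : Measurable fun ω => ∫⁻ s, (a - b * (EReal.exp (ENNReal.log (p ω / q ω) + s))⁻¹) ∂S.1 :=
    hm2.comp hlog
  have hd : (ofPair P Q).1 = P.map fun ω => ENNReal.log (p ω / q ω) :=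
    pldMeasure_eq_map hp hq hP hQ
  change ∫⁻ l, (a - b * (EReal.exp l)⁻¹) ∂(Measure.conv (ofPair P Q).1 S.1) = _
  rw [Measure.lintegral_conv hm, hd, lintegral_map hm2 hlog, hP,
    lintegral_withDensity_eq_lintegral_mul _ hp hm3]
  refine lintegral_congr_ae ?_
  filter_upwards [pfin, qfin] with ω h1 h2
  simp only [Pi.mul_apply, hockeyStick]
  rcases eq_or_ne (p ω) 0 with h0 | h0
  · simp [h0]
  rw [← lintegral_const_mul _ (by fun_prop)]
  refine lintegral_congr_ae ?_
  filter_upwards [S.ae_ne_bot] with s hs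
  rw [EReal.exp_add, ENNReal.exp_log, ENNReal.mul_sub (fun _ _ => h1.ne), mul_comm a,
    ENNReal.mul_inv (Or.inl (by simp [ENNReal.div_eq_zero_iff, h0, h2.ne]))
      (Or.inr (by simpa using hs)),
    ENNReal.inv_div (Or.inl h2.ne) (Or.inr h0)]
  congr 1
  calc p ω * (b * (q ω / p ω * (EReal.exp s)⁻¹)) = p ω * (q ω / p ω) * (b * (EReal.exp s)⁻¹) := by
        ring
    _ = _ := by rw [ENNReal.mul_div_cancel h0 h1.ne]; ring

/-- Adaptive composition: if the second round is dominated by `S` whatever the first outcome is,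
then the composition is dominated by the convolution. -/
theorem mul_compProd_le {X Y Z : Type} [MeasurableSpace X] [MeasurableSpace Y] [MeasurableSpace Z]
    (κ₁ κ₂ : Kernel X Y) [IsMarkovKernel κ₁] [IsMarkovKernel κ₂] (η₁ η₂ : Kernel (X × Y) Z)
    [IsMarkovKernel η₁] [IsMarkovKernel η₂] (x : X) (S : PLD)
    (h : ∀ y, ∀ a b : ℝ≥0∞, a ≠ ∞ → b ≠ ∞ → ∀ A, MeasurableSet A →
      a * η₁ (x, y) A ≤ b * η₂ (x, y) A + hockeyStick a b S)
    {a b : ℝ≥0∞} (ha : a ≠ ∞) (hb : b ≠ ∞) {A : Set (Y × Z)} (hA : MeasurableSet A) :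
    a * (κ₁.compProd η₁) x A ≤ b * (κ₂.compProd η₂) x A +
      hockeyStick a b ((ofPair (κ₁ x) (κ₂ x)).conv S) := by
  set P := κ₁ x
  set Q := κ₂ x
  have mp := Measure.measurable_rnDeriv P (P + Q)
  have mq := Measure.measurable_rnDeriv Q (P + Q)
  have hP := Measure.withDensity_rnDeriv_eq P (P + Q)
    (Measure.AbsolutelyContinuous.rfl.add_right Q)
  have hQ := Measure.withDensity_rnDeriv_eq Q (P + Q)
    (by rw [add_comm]; exact Measure.AbsolutelyContinuous.rfl.add_right P)
  have m1 : Measurable fun y => η₁ (x, y) (Prod.mk y ⁻¹' A) :=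
    (Kernel.measurable_kernel_prodMk_left' hA x)
  have m2 : Measurable fun y => η₂ (x, y) (Prod.mk y ⁻¹' A) :=
    (Kernel.measurable_kernel_prodMk_left' hA x)
  have mm1 : Measurable fun y => P.rnDeriv (P + Q) y * η₁ (x, y) (Prod.mk y ⁻¹' A) := mp.mul m1
  have mm2 : Measurable fun y => Q.rnDeriv (P + Q) y * η₂ (x, y) (Prod.mk y ⁻¹' A) := mq.mul m2
  have e1 : (κ₁.compProd η₁) x A =
      ∫⁻ y, P.rnDeriv (P + Q) y * η₁ (x, y) (Prod.mk y ⁻¹' A) ∂(P + Q) := by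
    rw [Kernel.compProd_apply hA]
    change ∫⁻ y, η₁ (x, y) (Prod.mk y ⁻¹' A) ∂P = _
    conv_lhs => rw [← hP]
    exact lintegral_withDensity_eq_lintegral_mul _ mp m1
  have e2 : (κ₂.compProd η₂) x A =
      ∫⁻ y, Q.rnDeriv (P + Q) y * η₂ (x, y) (Prod.mk y ⁻¹' A) ∂(P + Q) := by
    rw [Kernel.compProd_apply hA]
    change ∫⁻ y, η₂ (x, y) (Prod.mk y ⁻¹' A) ∂Q = _
    conv_lhs => rw [← hQ]
    exact lintegral_withDensity_eq_lintegral_mul _ mq m2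
  rw [e1, e2, hockeyStick_conv mp mq hP.symm hQ.symm, ← lintegral_const_mul _ mm1,
    ← lintegral_const_mul _ mm2, ← lintegral_add_left (mm2.const_mul b)]
  refine lintegral_mono_ae ?_
  filter_upwards [Measure.rnDeriv_ne_top P (P + Q), Measure.rnDeriv_ne_top Q (P + Q)] with y h1 h2
  -- The densities are absorbed into the prices, which is why `h` is assumed at all finite prices.
  rw [← mul_assoc, ← mul_assoc]
  exact h y _ _ (ENNReal.mul_ne_top ha h1) (ENNReal.mul_ne_top hb h2) _
    (measurable_prodMk_left hA)

/-- Adaptive composition: near-optimal tests for the second round, at the prices determined by the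
first outcome, combine to a near-optimal test for the composition. -/
theorem mul_compProd_ge {X Z : Type} [MeasurableSpace X] [MeasurableSpace Z]
    (κ₁ κ₂ : Kernel X unitInterval) [IsMarkovKernel κ₁] [IsMarkovKernel κ₂]
    (η₁ η₂ : Kernel (X × unitInterval) Z)
    [IsMarkovKernel η₁] [IsMarkovKernel η₂] (x : X) (S : PLD) {ν : Measure unitInterval}
    [IsStandard ν] (h₁ : κ₁ x = IsStandard.fst ν) (h₂ : κ₂ x = IsStandard.snd ν)
    {a b δ : ℝ≥0∞} {A : Set (unitInterval × Z)} (hA : MeasurableSet A)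
    (h : ∀ y : unitInterval, b * ENNReal.ofReal (1 - y) * η₂ (x, y) (Prod.mk y ⁻¹' A) +
      hockeyStick (a * ENNReal.ofReal y) (b * ENNReal.ofReal (1 - y)) S ≤
        a * ENNReal.ofReal y * η₁ (x, y) (Prod.mk y ⁻¹' A) + δ) :
    b * (κ₂.compProd η₂) x A + hockeyStick a b ((ofStandard ν).conv S) ≤
      a * (κ₁.compProd η₁) x A + δ * 2 := by
  have mp := IsStandard.measurable_fst
  have mq := IsStandard.measurable_snd
  have m1 : Measurable fun y => η₁ (x, y) (Prod.mk y ⁻¹' A) :=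
    (Kernel.measurable_kernel_prodMk_left' hA x)
  have m2 : Measurable fun y => η₂ (x, y) (Prod.mk y ⁻¹' A) :=
    (Kernel.measurable_kernel_prodMk_left' hA x)
  have mm1 : Measurable fun y : unitInterval =>
      ENNReal.ofReal y * η₁ (x, y) (Prod.mk y ⁻¹' A) := mp.mul m1
  have mm2 : Measurable fun y : unitInterval =>
      ENNReal.ofReal (1 - y) * η₂ (x, y) (Prod.mk y ⁻¹' A) := mq.mul m2
  have e1 : (κ₁.compProd η₁) x A =
      ∫⁻ y : unitInterval, ENNReal.ofReal y * η₁ (x, y) (Prod.mk y ⁻¹' A) ∂ν := by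
    rw [Kernel.compProd_apply hA, h₁]
    exact lintegral_withDensity_eq_lintegral_mul _ mp m1
  have e2 : (κ₂.compProd η₂) x A =
      ∫⁻ y : unitInterval, ENNReal.ofReal (1 - y) * η₂ (x, y) (Prod.mk y ⁻¹' A) ∂ν := by
    rw [Kernel.compProd_apply hA, h₂]
    exact lintegral_withDensity_eq_lintegral_mul _ mq m2
  have e3 : hockeyStick a b ((ofStandard ν).conv S) = ∫⁻ y : unitInterval,
      hockeyStick (a * ENNReal.ofReal y) (b * ENNReal.ofReal (1 - y)) S ∂ν :=
    hockeyStick_conv (P := IsStandard.fst ν) (Q := IsStandard.snd ν) mp mq rfl rfl a b S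
  have e4 : δ * 2 = ∫⁻ _ : unitInterval, δ ∂ν := by
    rw [lintegral_const, IsStandard.measure_univ]
  rw [e1, e2, e3, e4, ← lintegral_const_mul _ mm1, ← lintegral_const_mul _ mm2,
    ← lintegral_add_left (mm2.const_mul b), ← lintegral_add_left (mm1.const_mul a)]
  refine lintegral_mono fun y => ?_
  rw [← mul_assoc, ← mul_assoc]
  exact h y

theorem hockeyStick_le_left (a b : ℝ≥0∞) (L : PLD) : hockeyStick a b L ≤ a := by
  calc hockeyStick a b L ≤ ∫⁻ _, a ∂L.1 := lintegral_mono fun _ => tsub_le_self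
    _ = a := by rw [lintegral_const, measure_univ, mul_one]

/-- A countable family of near-optimal elements of a set, at all prices. -/
theorem exists_hockeyStick_sup_image_le {B : Set PLD} (hB : B.Nonempty) (f : PLD → PLD)
    {δ : NNReal} (hδ : 0 < δ) :
    ∃ c : ℕ × ℕ → PLD, (∀ j, c j ∈ B) ∧ ∀ a b : NNReal, hockeyStick a b (sup (f '' B)) ≤
      hockeyStick a b (f (c (⌊a / δ⌋₊, ⌊b / δ⌋₊))) + 3 * δ := by
  have hex : ∀ j : ℕ × ℕ, ∃ L ∈ B, hockeyStick ((j.1 * δ : NNReal) : ℝ≥0∞) (j.2 * δ : NNReal)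
      (sup (f '' B)) ≤ hockeyStick ((j.1 * δ : NNReal) : ℝ≥0∞) (j.2 * δ : NNReal) (f L) + δ := by
    intro j
    -- If every `f L` fell short by `δ`, so would their supremum, because `hockeyStick` commutes
    -- with `sup`; but the supremum is finite.
    by_contra! hcon
    have hfin := ne_top_of_le_ne_top ENNReal.coe_ne_top (hockeyStick_le_left
      ((j.1 * δ : NNReal) : ℝ≥0∞) (j.2 * δ : NNReal) (sup (f '' B)))
    have hle : hockeyStick ((j.1 * δ : NNReal) : ℝ≥0∞) (j.2 * δ : NNReal) (sup (f '' B)) ≤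
        hockeyStick ((j.1 * δ : NNReal) : ℝ≥0∞) (j.2 * δ : NNReal) (sup (f '' B)) - δ := by
      conv_lhs => rw [hockeyStick_sup (hB.image f)]
      refine iSup₂_le ?_
      rintro _ ⟨L, hL, rfl⟩
      exact ENNReal.le_sub_of_add_le_right ENNReal.coe_ne_top (hcon L hL).le
    obtain ⟨L, hL⟩ := hB
    have hpos : hockeyStick ((j.1 * δ : NNReal) : ℝ≥0∞) (j.2 * δ : NNReal) (sup (f '' B)) ≠ 0 :=
      (zero_le.trans_lt (hcon L hL)).ne'
    exact (ENNReal.sub_lt_self hfin hpos (by exact_mod_cast hδ.ne')).not_ge hle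
  choose c hc hcle using hex
  refine ⟨c, hc, fun a b => ?_⟩
  have hfl : ∀ r : NNReal, (⌊r / δ⌋₊ * δ : NNReal) ≤ r ∧ r ≤ ⌊r / δ⌋₊ * δ + δ := fun r => by
    refine ⟨(le_div_iff₀ hδ).1 (Nat.floor_le zero_le), ?_⟩
    rw [← add_one_mul]
    exact (div_le_iff₀ hδ).1 (Nat.lt_floor_add_one _).le
  -- Rounding both prices down costs `δ` through `a`, near-optimality at the grid point costs `δ`,
  -- and returning to the true prices costs `δ` through `b`.
  calc hockeyStick a b (sup (f '' B))
      ≤ hockeyStick ((⌊a / δ⌋₊ * δ : NNReal) : ℝ≥0∞) (⌊b / δ⌋₊ * δ : NNReal) (sup (f '' B)) +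
          (δ + 0) :=
        hockeyStick_le_add ENNReal.coe_ne_top (by exact_mod_cast (hfl a).2)
          (by rw [add_zero]; exact_mod_cast (hfl b).1) _
    _ ≤ hockeyStick ((⌊a / δ⌋₊ * δ : NNReal) : ℝ≥0∞) (⌊b / δ⌋₊ * δ : NNReal)
          (f (c (⌊a / δ⌋₊, ⌊b / δ⌋₊))) + δ + (δ + 0) := by
        gcongr
        exact hcle (⌊a / δ⌋₊, ⌊b / δ⌋₊)
    _ ≤ hockeyStick a b (f (c (⌊a / δ⌋₊, ⌊b / δ⌋₊))) + (0 + δ) + δ + (δ + 0) := by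
        gcongr
        exact hockeyStick_le_add ENNReal.coe_ne_top
          (by rw [add_zero]; exact_mod_cast (hfl a).1) (by exact_mod_cast (hfl b).2) _
    _ = _ := by ring

end PLD

/-! ### Values of privacy rules -/

/-- The supremum of the privacy loss over adversaries that play `k` rounds, where `m` gives the
allowed moves after a sequence of moves. -/
noncomputable def PLD.value : ℕ → (List PLD → Set PLD) → PLD
  -- `Id` is neutral for `conv`, so the value of a one-round game is the supremum of its moves.
  | 0, _ => PLD.id
  | k + 1, m => PLD.sup ((fun L => L.conv (PLD.value k fun l => m (L :: l))) '' m [])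

namespace PrivacyRule

variable {𝒟 : Type u}

/-- The moves that a rule of length `k` allows after a sequence of moves; there are none once the
sequence has length at least `k`. -/
def next {k : ℕ} (Γ : PrivacyRule k) (l : List PLD) : Set PLD :=
  {L | ∃ h : l.length < k, L ∈ Γ.moves l h}

theorem next_nonempty {k : ℕ} (Γ : PrivacyRule k) {l : List PLD} (h : l.length < k) :
    (Γ.next l).Nonempty :=
  ⟨PLD.id, h, Γ.id_mem l h⟩

theorem next_nil {k : ℕ} (Γ : PrivacyRule k) (hk : 0 < k) : Γ.next [] = Γ.moves [] hk :=
  Set.ext fun _ => ⟨fun ⟨_, h⟩ => h, fun h => ⟨hk, h⟩⟩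

/-- With the length bound moved into membership, passing to `Γ_L` only prefixes `L` to the history,
which is how `value` unfolds. -/
theorem next_fixFirst {k : ℕ} (Γ : PrivacyRule k) (L : PLD) :
    (Γ.fixFirst L).next = fun l => Γ.next (L :: l) := by
  funext l
  ext K
  refine ⟨fun ⟨h, hK⟩ => ⟨?_, hK⟩, fun ⟨h, hK⟩ => ⟨?_, hK⟩⟩
  · rw [List.length_cons]; omega
  · rw [List.length_cons] at h; omega

theorem conv_value_le {m : List PLD → Set PLD} {L : PLD} (hL : L ∈ m []) (k : ℕ) :
    L.conv (PLD.value k fun l => m (L :: l)) ≤ PLD.value (k + 1) m :=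
  (PLD.isLUB_sup (Set.Nonempty.image _ ⟨L, hL⟩)).1 ⟨L, hL, rfl⟩

/-- No adversary exceeds the value of the rule. -/
theorem mul_law_le (D₁ D₂ : 𝒟) {K : ℕ} (Γ : PrivacyRule K) {X : Type} [MeasurableSpace X] {k : ℕ}
    (M : AdaptiveMechanism 𝒟 X k) :
    ∀ (past : List PLD) (x : X), Γ.Respects D₁ D₂ M past x → ∀ a b : ℝ≥0∞, a ≠ ∞ → b ≠ ∞ →
      ∀ A : Set M.Output, MeasurableSet A → a * M.law D₁ x A ≤ b * M.law D₂ x A +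
        PLD.hockeyStick a b (PLD.value k fun l => Γ.next (past ++ l)) := by
  induction M with
  | single κ hκ =>
    intro past x h a b ha hb A hA
    have := hκ D₁
    have := hκ D₂
    have hL : PLD.ofPair (κ D₁ x) (κ D₂ x) ∈ Γ.next (past ++ []) := by
      rw [List.append_nil]; exact h
    have hle := conv_value_le (m := fun l => Γ.next (past ++ l)) hL 0
    rw [PLD.value, PLD.conv_id] at hle
    exact (PLD.mul_measure_le_add_hockeyStick (κ D₁ x) (κ D₂ x) a b hA).trans
      (add_le_add le_rfl (PLD.hockeyStick_mono hle hb))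
  | @cons X Y _ _ k κ hκ rest ih =>
    intro past x h a b ha hb A hA
    have := hκ D₁
    have := hκ D₂
    have hL : PLD.ofPair (κ D₁ x) (κ D₂ x) ∈ Γ.next (past ++ []) := by
      rw [List.append_nil]; exact h.1
    have hle := conv_value_le (m := fun l => Γ.next (past ++ l)) hL k
    -- The first move depends on `x` but not on the outcome `y`, so a single value bounds every
    -- continuation.
    refine (PLD.mul_compProd_le (κ D₁) (κ D₂) (rest.law D₁) (rest.law D₂) x _
      (fun y a b ha hb A hA => ?_) ha hb hA).trans
      (add_le_add le_rfl (PLD.hockeyStick_mono hle hb))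
    have := ih _ (x, y) (h.2 y) a b ha hb A hA
    simpa only [List.append_assoc, List.singleton_append] using this

end PrivacyRule

/-- On the dataset `D₁` the first distributions of pairs with given standard measures, on all other
datasets the second ones. -/
noncomputable def standardKernel {𝒟 : Type u} (D₁ : 𝒟) {X J : Type} [MeasurableSpace X]
    [MeasurableSpace J] [Countable J] [DiscreteMeasurableSpace J]
    (ν : J → Measure unitInterval) (j : X → J) (hj : Measurable j) (D : 𝒟) :
    Kernel X unitInterval :=
  open Classical in
  if D = D₁ then (Kernel.ofFunOfCountable fun i => IsStandard.fst (ν i)).comap j hj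
  else (Kernel.ofFunOfCountable fun i => IsStandard.snd (ν i)).comap j hj

section standardKernel

variable {𝒟 : Type u} (D₁ : 𝒟) {X J : Type} [MeasurableSpace X] [MeasurableSpace J] [Countable J]
  [DiscreteMeasurableSpace J] (ν : J → Measure unitInterval) (j : X → J) (hj : Measurable j)

theorem standardKernel_self (x : X) :
    standardKernel D₁ ν j hj D₁ x = IsStandard.fst (ν (j x)) := by
  rw [standardKernel, if_pos rfl]
  rfl

theorem standardKernel_of_ne {D : 𝒟} (hD : D ≠ D₁) (x : X) :
    standardKernel D₁ ν j hj D x = IsStandard.snd (ν (j x)) := by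
  rw [standardKernel, if_neg hD]
  rfl

theorem isMarkovKernel_standardKernel [∀ i, IsStandard (ν i)] (D : 𝒟) :
    IsMarkovKernel (standardKernel D₁ ν j hj D) := by
  refine ⟨fun x => ?_⟩
  by_cases hD : D = D₁
  · subst hD
    rw [standardKernel_self]
    infer_instance
  · rw [standardKernel_of_ne D₁ ν j hj hD]
    infer_instance

end standardKernel

namespace PrivacyRule

/-- Rules have adversaries, on any space of initial histories, that approximate the value of the
rule at all prices simultaneously. -/
theorem exists_respects_near_value {𝒟 : Type u} {D₁ D₂ : 𝒟} (hD : D₁ ≠ D₂) {K : ℕ}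
    (Γ : PrivacyRule K) (k : ℕ) :
    ∀ (ε : NNReal), 0 < ε → ∀ (X ι : Type) [MeasurableSpace X] [MeasurableSpace ι] [Countable ι]
      [DiscreteMeasurableSpace ι] (past : ι → List PLD), (∀ i, (past i).length + (k + 1) = K) →
      ∀ (n : X → ι), Measurable n → ∀ (a b : X → NNReal), Measurable a → Measurable b →
      ∃ M : AdaptiveMechanism 𝒟 X (k + 1), (∀ x, Γ.Respects D₁ D₂ M (past (n x)) x) ∧
        ∃ A : Set (X × M.Output), MeasurableSet A ∧ ∀ x,
          b x * M.law D₂ x (Prod.mk x ⁻¹' A) +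
            PLD.hockeyStick (a x) (b x) (PLD.value (k + 1) fun l => Γ.next (past (n x) ++ l)) ≤
          a x * M.law D₁ x (Prod.mk x ⁻¹' A) + ε := by
  classical
  -- The generality is forced by the induction: later rounds see a larger history, their prices vary
  -- with it, and the moves made so far depend on it through a countable index.
  induction k with
  | zero =>
    intro ε hε X ι _ _ _ _ past hpast n hn a b ha hb
    set δ : NNReal := ε / 3
    have hδ : 0 < δ := by positivity
    let m : ι → List PLD → Set PLD := fun i l => Γ.next (past i ++ l)
    have hm : ∀ i, (m i []).Nonempty := fun i => Γ.next_nonempty (by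
      have := hpast i
      rw [List.append_nil]; omega)
    choose c hc hcle using fun i => PLD.exists_hockeyStick_sup_image_le (hm i)
      (fun L => L.conv PLD.id) hδ
    choose ν hν hL using fun j : ι × ℕ × ℕ => (c j.1 j.2).exists_eq_ofStandard
    -- The next move depends only on the index of the past and on the grid cell of the prices. As
    -- this state is countable, no measurability of the choice `c` is needed.
    let j : X → ι × ℕ × ℕ := fun x => (n x, ⌊a x / δ⌋₊, ⌊b x / δ⌋₊)
    have hj : Measurable j := hn.prodMk ((Nat.measurable_floor.comp (ha.div_const δ)).prodMk
      (Nat.measurable_floor.comp (hb.div_const δ)))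
    have hκ := isMarkovKernel_standardKernel D₁ ν j hj
    have := hκ D₁
    have := hκ D₂
    have hpld : ∀ x, PLD.ofPair (standardKernel D₁ ν j hj D₁ x) (standardKernel D₁ ν j hj D₂ x) =
        c (j x).1 (j x).2 := fun x => by
      rw [hL]
      exact PLD.ofPair_congr (standardKernel_self D₁ ν j hj x)
        (standardKernel_of_ne D₁ ν j hj hD.symm x)
    refine ⟨.single (standardKernel D₁ ν j hj) hκ, fun x => ?_, {z : X × unitInterval |
      (b z.1 : ℝ≥0∞) * ENNReal.ofReal (1 - z.2) < a z.1 * ENNReal.ofReal z.2}, ?_, fun x => ?_⟩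
    · have hmem : c (j x).1 (j x).2 ∈ Γ.next (past (n x) ++ []) := hc (n x) (j x).2
      rw [List.append_nil, ← hpld] at hmem
      exact hmem
    · exact measurableSet_lt
        ((hb.comp measurable_fst).coe_nnreal_ennreal.mul
          (IsStandard.measurable_snd.comp measurable_snd))
        ((ha.comp measurable_fst).coe_nnreal_ennreal.mul
          (IsStandard.measurable_fst.comp measurable_snd))
    · have key := PLD.mul_measure_eq_add_hockeyStick IsStandard.measurable_fst
        IsStandard.measurable_snd (standardKernel_self D₁ ν j hj x)
        (standardKernel_of_ne D₁ ν j hj hD.symm x) (a x) (b x)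
      rw [hpld] at key
      have hsel := hcle (n x) (a x) (b x)
      rw [PLD.conv_id] at hsel
      refine (add_le_add le_rfl hsel).trans ?_
      rw [← add_assoc]
      have h3 : (ε : ℝ≥0∞) = 3 * δ := by
        have : ε = 3 * δ := by
          simp only [δ]
          rw [← mul_div_assoc, mul_div_cancel_left₀]
          norm_num
        exact_mod_cast this
      rw [h3]
      exact add_le_add key.ge le_rfl
  | succ k ih =>
    intro ε hε X ι _ _ _ _ past hpast n hn a b ha hb
    -- Choosing the first move costs `3 δ`. The error `δ` of the later rounds is integrated against
    -- a standard measure, of mass `2`.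
    set δ : NNReal := ε / 5
    have hδ : 0 < δ := by positivity
    let m : ι → List PLD → Set PLD := fun i l => Γ.next (past i ++ l)
    have hm : ∀ i, (m i []).Nonempty := fun i => Γ.next_nonempty (by
      have := hpast i
      rw [List.append_nil]; omega)
    choose c hc hcle using fun i => PLD.exists_hockeyStick_sup_image_le (hm i)
      (fun L => L.conv (PLD.value (k + 1) fun l => m i (L :: l))) hδ
    choose ν hν hL using fun j : ι × ℕ × ℕ => (c j.1 j.2).exists_eq_ofStandard
    let j : X → ι × ℕ × ℕ := fun x => (n x, ⌊a x / δ⌋₊, ⌊b x / δ⌋₊)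
    have hj : Measurable j := hn.prodMk ((Nat.measurable_floor.comp (ha.div_const δ)).prodMk
      (Nat.measurable_floor.comp (hb.div_const δ)))
    have hκ := isMarkovKernel_standardKernel D₁ ν j hj
    have := hκ D₁
    have := hκ D₂
    have hpld : ∀ x, PLD.ofPair (standardKernel D₁ ν j hj D₁ x) (standardKernel D₁ ν j hj D₂ x) =
        c (j x).1 (j x).2 := fun x => by
      rw [hL]
      exact PLD.ofPair_congr (standardKernel_self D₁ ν j hj x)
        (standardKernel_of_ne D₁ ν j hj hD.symm x)
    -- After outcome `y`, the prices are multiplied by the densities `y` and `1 - y`, and the chosen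
    -- move joins the past.
    obtain ⟨rest, hrest, A, hA, hAle⟩ := ih δ hδ (X × unitInterval) (ι × ℕ × ℕ)
      (fun i => past i.1 ++ [c i.1 i.2])
      (fun i => by have := hpast i.1; rw [List.length_append, List.length_singleton]; omega)
      (fun z => j z.1) (hj.comp measurable_fst)
      (fun z => a z.1 * Real.toNNReal z.2) (fun z => b z.1 * Real.toNNReal (1 - z.2))
      (by fun_prop) (by fun_prop)
    refine ⟨.cons (standardKernel D₁ ν j hj) hκ rest, fun x => ⟨?_, fun y => ?_⟩, ?_⟩
    · rw [hpld]
      have hmem : c (j x).1 (j x).2 ∈ Γ.next (past (n x) ++ []) := hc (n x) (j x).2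
      rw [List.append_nil] at hmem
      exact hmem
    · rw [hpld]
      exact hrest (x, y)
    · refine ⟨{z : X × (unitInterval × rest.Output) | ((z.1, z.2.1), z.2.2) ∈ A}, ?_, fun x => ?_⟩
      · have : Measurable fun z : X × (unitInterval × rest.Output) => ((z.1, z.2.1), z.2.2) := by
          fun_prop
        exact this hA
      · have hB : MeasurableSet {z : unitInterval × rest.Output | ((x, z.1), z.2) ∈ A} := by
          have : Measurable fun z : unitInterval × rest.Output => ((x, z.1), z.2) := by
            fun_prop
          exact this hA
        have key := PLD.mul_compProd_ge (standardKernel D₁ ν j hj D₁)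
          (standardKernel D₁ ν j hj D₂) (rest.law D₁) (rest.law D₂) x
          (PLD.value (k + 1) fun l => m (n x) (c (j x).1 (j x).2 :: l))
          (standardKernel_self D₁ ν j hj x) (standardKernel_of_ne D₁ ν j hj hD.symm x)
          (a := a x) (b := b x) (δ := δ) hB (fun y => by
            have := hAle (x, y)
            simp only [List.append_assoc, List.singleton_append, ENNReal.coe_mul] at this
            exact this)
        rw [← hL] at key
        refine (add_le_add le_rfl (hcle (n x) (a x) (b x))).trans ?_
        rw [← add_assoc]
        refine (add_le_add key le_rfl).trans (le_of_eq ?_)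
        have h5 : (ε : ℝ≥0∞) = δ * 2 + 3 * δ := by
          have : ε = δ * 2 + 3 * δ := by
            simp only [δ]
            rw [mul_comm, ← add_mul, ← mul_div_assoc]
            norm_num
          exact_mod_cast this
        rw [h5, ← add_assoc]
        rfl

end PrivacyRule

namespace PrivacyRule

/-- The value of a rule is the least upper bound of the privacy loss over its adversaries. -/
theorem isLUB_value {𝒟 : Type u} {D₁ D₂ : 𝒟} (hD : D₁ ≠ D₂) {k : ℕ} (hk : 0 < k)
    (Γ : PrivacyRule k) :
    IsLUB {L | ∃ M ∈ Γ.Adv D₁ D₂, L = M.pld D₁ D₂} (PLD.value k Γ.next) := by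
  constructor
  · rintro _ ⟨M, hM, rfl⟩
    refine PLD.le_iff_hockeyStick_le.2 fun a b => ?_
    exact PLD.hockeyStick_ofPair_le _ _ ENNReal.coe_ne_top fun A hA =>
      Γ.mul_law_le D₁ D₂ M [] () hM a b ENNReal.coe_ne_top ENNReal.coe_ne_top A hA
  · intro U hU
    obtain ⟨k, rfl⟩ := Nat.exists_eq_succ_of_ne_zero hk.ne'
    refine PLD.le_iff_hockeyStick_le.2 fun a b => ENNReal.le_of_forall_pos_le_add fun ε hε _ => ?_
    obtain ⟨M, hM, A, hA, hle⟩ := Γ.exists_respects_near_value hD k ε hε Unit Unit (fun _ => [])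
      (fun _ => by simp) id measurable_id (fun _ => a) (fun _ => b) measurable_const
      measurable_const
    have hMU : M.pld D₁ D₂ ≤ U := hU ⟨M, hM (), rfl⟩
    have hA' := PLD.mul_measure_le_add_hockeyStick (M.law D₁ ()) (M.law D₂ ()) a b
      (measurable_prodMk_left (x := ()) hA)
    have h := (hle ()).trans (add_le_add hA' le_rfl)
    -- Cancelling the finite term `b * M.law D₂` bounds the divergence of the value by that of `M`
    -- plus `ε`.
    rw [add_assoc, ENNReal.add_le_add_iff_left
      (ENNReal.mul_ne_top ENNReal.coe_ne_top (measure_ne_top _ _))] at h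
    exact h.trans (add_le_add (PLD.le_iff_hockeyStick_le.1 hMU a b) le_rfl)

theorem pld_eq_value {𝒟 : Type u} {D₁ D₂ : 𝒟} (hD : D₁ ≠ D₂) {k : ℕ} (hk : 0 < k)
    (Γ : PrivacyRule k) : Γ.pld D₁ D₂ = PLD.value k Γ.next :=
  PLD.sup_eq_of_isLUB (Γ.isLUB_value hD hk)

end PrivacyRule

theorem mainTheorem4 {𝒟 : Type u} (D₁ D₂ : 𝒟) (hD : D₁ ≠ D₂) {k : ℕ} (hk : 0 < k)
    (Γ : PrivacyRule k) :
    IsLUB {L | ∃ M ∈ Γ.Adv D₁ D₂, L = M.pld D₁ D₂} (Γ.pld D₁ D₂) ∧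
    (k = 1 →
      IsLUB (Γ.moves [] hk) (Γ.pld D₁ D₂) ∧
      Γ.pld D₁ D₂ = PLD.sup (Γ.moves [] hk)) ∧
    (1 < k →
      IsLUB {K | ∃ L ∈ Γ.moves [] hk, K = L.conv ((Γ.fixFirst L).pld D₁ D₂)} (Γ.pld D₁ D₂) ∧
      Γ.pld D₁ D₂ =
        PLD.sup {K | ∃ L ∈ Γ.moves [] hk, K = L.conv ((Γ.fixFirst L).pld D₁ D₂)}) := by
  rw [Γ.pld_eq_value hD hk]
  refine ⟨Γ.isLUB_value hD hk, ?_, fun h1 => ?_⟩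
  · rintro rfl
    have hne : (Γ.moves [] hk).Nonempty := ⟨PLD.id, Γ.id_mem _ _⟩
    have hv : PLD.value 1 Γ.next = PLD.sup (Γ.moves [] hk) := by
      simp only [PLD.value, PLD.conv_id, Set.image_id', Γ.next_nil hk]
    rw [hv]
    exact ⟨PLD.isLUB_sup hne, rfl⟩
  -- The length becomes `1 + k + 1`, so `value` unfolds once and each `Γ_L` has positive length `1 +
  -- k`.
  · obtain ⟨k, rfl⟩ := Nat.exists_eq_add_of_lt h1
    have hset : {K | ∃ L ∈ Γ.moves [] hk, K = L.conv ((Γ.fixFirst L).pld D₁ D₂)} =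
        (fun L => L.conv (PLD.value (1 + k) fun l => Γ.next (L :: l))) '' Γ.next [] := by
      ext K
      simp only [Set.mem_ofPred_eq, Set.mem_image, Γ.next_nil hk]
      refine exists_congr fun L => and_congr_right fun _ => ?_
      rw [(Γ.fixFirst L).pld_eq_value hD (by omega), Γ.next_fixFirst, eq_comm]
      rfl
    have hv : PLD.value (1 + k + 1) Γ.next =
        PLD.sup {K | ∃ L ∈ Γ.moves [] hk, K = L.conv ((Γ.fixFirst L).pld D₁ D₂)} := by
      rw [hset, PLD.value]
    rw [hv]
    exact ⟨PLD.isLUB_sup ⟨_, PLD.id, Γ.id_mem _ _, rfl⟩, rfl⟩
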